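/- Fix an integer $N\ge 3$ and put $q=q(N)=\frac1N\Big(\frac{2}{1+\sqrt{1-4/N^2}}\Big)\in(0,1)$ and $[n]_q=q^{-(n-1)}\frac{1-q^{2n}}{1-q^2}$ for integers $n\ge 0$. Let $H_1=\mathbb C^N$ with standard orthonormal basis $e_1,\dots,e_N$, write $\iota$ for identity maps, and let $T_1=\sum_{i=1}^N e_i\otimes e_i$ and $$T_r=\sum_{1\le i(1),\dots,i(r)\le N} e_{i(1)}\otimes\cdots\otimes e_{i(r)}\otimes e_{i(r)}\otimes\cdots\otimes e_{i(1)}\in H_1^{\otimes 2r}\qquad(r\ge 0),$$ regarded as linear maps $\mathbb C\to H_1^{\otimes 2r}$ (with $T_0=\iota_{\mathbb C}$). The Jones–Wenzl projections $p_k$ on $H_1^{\otimes k}$ are given by $p_0=\iota_{\mathbb C}$, $p_1=\iota_{H_1}$ and, for $k\ge2$, $$p_k=\iota_{H_1}\otimes p_{k-1}-\frac{[k-1]_q}{[k]_q}\,(\iota_{H_1}\otimes p_{k-1})(T_1T_1^*\otimes\iota_{H_1^{\otimes k-2}})(\iota_{H_1}\otimes p_{k-1}),$$ and $H_k=p_k(H_1^{\otimes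 k})$ is the Hilbert space of the $k$-th irreducible representation of the free orthogonal quantum group $O_N^+$. A triple $(k,l,m)$ of non-negative integers is admissible if $k=l+m-2r$ for some integer $0\le r\le\min\{l,m\}$. For an admissible triple let $$A_k^{l,m}=(p_l\otimes p_m)\big(\iota_{H_1^{\otimes (l-r)}}\otimes T_r\otimes\iota_{H_1^{\otimes (m-r)}}\big)p_k:\ H_k\to H_l\otimes H_m,$$ $$\theta_q(k,l,m)=\mathrm{Tr}_{H_k}\big((A_k^{l,m})^*A_k^{l,m}\big),\qquad \alpha_k^{l,m}=\|A_k^{l,m}\|^{-1}A_k^{l,m}.$$ **Proposition 3.1 (rapid decay inequality).** Let $N\ge3$ and let $(k,l,m)$ be an admissible triple. Then for all unit vectors $\xi\in H_k$, $\eta\in H_l$, $\zeta\in H_m$, $$|\langle \alpha_k^{l,m}(\xi)\,|\,\eta\otimes\zeta\rangle|\ \le\ \Big(\frac{[k+1]_q}{\theta_q(k,l,m)}\Big)^{1/2}\ \le\ C(q)\,q^{\frac{l+m-k}{4}},$$ where $$C(q)=(1-q^2)^{-1/2}\Big(\prod_{s=1}^\infty\frac1{1-q^{2s}}\Big)^{3/2}.$$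 -/

import Mathlib

open scoped Kronecker

noncomputable section

namespace FreeOrth

/-- The quantum parameter `q(N) = (1/N) * (2 / (1 + √(1 - 4/N²)))`. -/
def qParam (N : ℕ) : ℝ :=
  1 / (N : ℝ) * (2 / (1 + Real.sqrt (1 - 4 / (N : ℝ) ^ 2)))

/-- The quantum integer `[n]_q = q^{-(n-1)} (1 - q^{2n}) / (1 - q²)`, for `q ≠ 0, ±1`. -/
def qInt (q : ℝ) (n : ℕ) : ℝ :=
  q ^ (-((n : ℤ) - 1)) * ((1 - q ^ (2 * n)) / (1 - q ^ 2))

/-- Words of length `k` in the letters `1, …, N`. They label the standard orthonormal basis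
`e_{i(1)} ⊗ ⋯ ⊗ e_{i(k)}` of `H₁^{⊗k} = (ℂ^N)^{⊗k}`. -/
abbrev Word (N k : ℕ) : Type := Fin k → Fin N

/-- The Hilbert space `H₁^{⊗k} = (ℂ^N)^{⊗k}`, through coordinates in its standard basis. -/
abbrev TensorPow (N k : ℕ) : Type := EuclideanSpace ℂ (Word N k)

/-- The Hilbert space `H₁^{⊗l} ⊗ H₁^{⊗m}`, through coordinates in its standard basis
`e_a ⊗ e_b`. -/
abbrev TensorPair (N l m : ℕ) : Type := EuclideanSpace ℂ (Word N l × Word N m)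

/-- The elementary tensor `η ⊗ ζ`. -/
def tmul {N l m : ℕ} (η : TensorPow N l) (ζ : TensorPow N m) : TensorPair N l m :=
  WithLp.toLp 2 fun w => η w.1 * ζ w.2

/-- `ι_{H₁} ⊗ M` on `H₁^{⊗(k+1)} = H₁ ⊗ H₁^{⊗k}`. -/
def idTensor {N k : ℕ} (M : Matrix (Word N k) (Word N k) ℂ) :
    Matrix (Word N (k + 1)) (Word N (k + 1)) ℂ :=
  fun i j => if i 0 = j 0 then M (Fin.tail i) (Fin.tail j) else 0

/-- `T₁ ⊗ ι : H₁^{⊗k} → H₁^{⊗(k+2)}`, where `T₁ = ∑ i, e_i ⊗ e_i`. -/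
def cupTensor (N k : ℕ) : Matrix (Word N (k + 2)) (Word N k) ℂ :=
  fun i j => if i 0 = i 1 ∧ Fin.tail (Fin.tail i) = j then 1 else 0

/-- The Jones–Wenzl projection `p_k` on `H₁^{⊗k}`, by the Wenzl recursion
`p_k = ι ⊗ p_{k-1} - ([k-1]_q / [k]_q) (ι ⊗ p_{k-1}) (T₁T₁* ⊗ ι) (ι ⊗ p_{k-1})`. -/
def jonesWenzl (N : ℕ) : (k : ℕ) → Matrix (Word N k) (Word N k) ℂ
  | 0 => 1
  | 1 => 1
  | k + 2 =>
    idTensor (jonesWenzl N (k + 1)) -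
      ((qInt (qParam N) (k + 1) / qInt (qParam N) (k + 2) : ℝ) : ℂ) •
        (idTensor (jonesWenzl N (k + 1)) *
          (cupTensor N k * (cupTensor N k).conjTranspose) *
          idTensor (jonesWenzl N (k + 1)))

/-- The highest weight space `H_k = p_k (H₁^{⊗k}) ⊆ H₁^{⊗k}`, the space of the irreducible
representation `v^k` of the free orthogonal quantum group of rank `N`. -/
def irrepSpace (N k : ℕ) : Submodule ℂ (TensorPow N k) :=
  LinearMap.range (Matrix.toEuclideanLin (jonesWenzl N k))

/-- `(k, l, m)` is admissible if `k = l + m - 2r` for some `0 ≤ r ≤ min l m`. -/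
def Admissible (k l m : ℕ) : Prop := ∃ r : ℕ, r ≤ min l m ∧ k + 2 * r = l + m

/-- `ι_{l-r} ⊗ T_r ⊗ ι_{m-r} : H₁^{⊗k} → H₁^{⊗l} ⊗ H₁^{⊗m}` for `k = l + m - 2r`, where
`T_r = ∑ i, e_{i(1)} ⊗ ⋯ ⊗ e_{i(r)} ⊗ e_{i(r)} ⊗ ⋯ ⊗ e_{i(1)}`. It sends `e_c` to the sum of the
`e_a ⊗ e_b` such that the first `l-r` letters of `a` are those of `c`, the last `m-r` letters of
`b` are those of `c`, and the last `r` letters of `a` are the first `r` letters of `b` in reverse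
order (positions are counted from `0`). -/
def nestedCup (N k l m r : ℕ) : Matrix (Word N l × Word N m) (Word N k) ℂ :=
  open Classical in
  fun w c =>
    if (∀ (x : Fin l) (y : Fin k), (x : ℕ) < l - r → (x : ℕ) = y → w.1 x = c y) ∧
        (∀ (x : Fin m) (y : Fin k), r ≤ (x : ℕ) → (l - r) + ((x : ℕ) - r) = y → w.2 x = c y) ∧
        (∀ (x : Fin l) (y : Fin m), (y : ℕ) < r → (x : ℕ) + y + 1 = l → w.1 x = w.2 y)
      then 1 else 0

/-- The three-vertex `A_k^{l,m} = (p_l ⊗ p_m)(ι_{l-r} ⊗ T_r ⊗ ι_{m-r}) p_k`, `r = (l+m-k)/2`,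
as an operator on `H_k`. Its values lie in `H_l ⊗ H_m ⊆ H₁^{⊗l} ⊗ H₁^{⊗m}`. -/
def threeVertex (N k l m : ℕ) : irrepSpace N k →L[ℂ] TensorPair N l m :=
  LinearMap.toContinuousLinearMap
    (Matrix.toEuclideanLin
        ((jonesWenzl N l ⊗ₖ jonesWenzl N m) * nestedCup N k l m ((l + m - k) / 2) *
          jonesWenzl N k)
      ∘ₗ (irrepSpace N k).subtype)

/-- The Hilbert space adjoint `(A_k^{l,m})* : H₁^{⊗l} ⊗ H₁^{⊗m} → H_k`. -/
def threeVertexAdj (N k l m : ℕ) : TensorPair N l m →ₗ[ℂ] irrepSpace N k :=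
  LinearMap.adjoint (𝕜 := ℂ) (E := irrepSpace N k) (F := TensorPair N l m)
    (threeVertex N k l m).toLinearMap

/-- The theta-net `θ_q(k,l,m) = Tr_{H_k} ((A_k^{l,m})* A_k^{l,m})`, `q = q(N)` (a real number:
the trace of a positive operator). -/
def thetaNet (N k l m : ℕ) : ℝ :=
  (LinearMap.trace ℂ (irrepSpace N k)
    (threeVertexAdj N k l m ∘ₗ (threeVertex N k l m).toLinearMap)).re

/-- The equivariant isometry `α_k^{l,m} = ‖A_k^{l,m}‖⁻¹ A_k^{l,m} : H_k → H_l ⊗ H_m`. -/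
def alpha (N k l m : ℕ) : irrepSpace N k →L[ℂ] TensorPair N l m :=
  ((‖threeVertex N k l m‖⁻¹ : ℝ) : ℂ) • threeVertex N k l m

/-- `C(q) = (1 - q²)^{-1/2} (∏_{s ≥ 1} 1 / (1 - q^{2s}))^{3/2}`. -/
def rdConst (q : ℝ) : ℝ :=
  (1 - q ^ 2) ^ (-(1 / 2 : ℝ)) * (∏' s : ℕ, 1 / (1 - q ^ (2 * (s + 1)))) ^ (3 / 2 : ℝ)

end FreeOrth

end

/-! Write l = a + r, m = b + r, k = a + b. The crux is the bubble identity A*A = λ p_k, with λ =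
∏_{i=1}^r [i][a+b+i+1] / ([a+i][b+i]). Since Tr p_k = [k+1], it gives θ = λ[k+1], so the middle
quantity of the theorem is λ^{-1/2}; it also gives ‖Aξ‖² = λ for every unit vector ξ.

For the first inequality, the projections fix ξ, η and ζ. So ⟨Aξ, η⊗ζ⟩ is the inner product of ξ
with the contraction of η⊗ζ along r nested arcs, and Cauchy–Schwarz bounds that contraction by
‖η‖‖ζ‖ (`norm_nestedCup_conjTranspose_tmul_le`). Normalising divides by ‖A‖ ≥ λ^{1/2}.

For the second, each factor of λ^{-1} is at most q/(1-q^{2i}) (`inv_arcFactor_le`), so λ^{-1} ≤ q^r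
∏ 1/(1-q^{2s}); take square roots and use r/2 = (l+m-k)/4. The constant obtained this way is smaller
than C(q).

The bubble identity is Temperley–Lieb calculus. Contracting the innermost arc of a three-vertex
gives a multiple d_r of the vertex with one arc less, where d_r obeys a recursion
(`CapCup.cap_mul_vertex`) solved by the factors above (`arcFactor_succ`). The calculus is done in a
single ring: caps and cups act on functions of infinite words, so a change in the number of strands
becomes a mere shift of positions. `wordOp` carries matrices faithfully into this ring. -/

namespace FreeOrth

/-! ### Temperley–Lieb calculus of caps, cups and Jones–Wenzl idempotents in one ring. -/

section TemperleyLieb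

variable {K R : Type*} [Field K] [Ring R] [Algebra K R]

/-- Caps `C i` and cups `D i` in positions `i, i + 1`, with loop value `δ`. -/
structure CapCup (δ : K) (C D : ℕ → R) : Prop where
  loop : ∀ i, C i * D i = algebraMap K R δ
  zigzag_left : ∀ i, C i * D (i + 1) = 1
  zigzag_right : ∀ i, C (i + 1) * D i = 1
  cap_cup_add_two : ∀ i j, i ≤ j → C i * D (j + 2) = D j * C i
  cap_add_two_cup : ∀ i j, i ≤ j → C (j + 2) * D i = D i * C j
  cup_cup : ∀ i j, i ≤ j → D (j + 2) * D i = D i * D j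
  cap_cap : ∀ i j, i ≤ j → C i * C (j + 2) = C j * C i

/-- A sequence of quantum integers `[n]` with `[2] = δ`, nonzero for `n > 0`. -/
structure IsQuantumInt (δ : K) (n : ℕ → K) : Prop where
  zero : n 0 = 0
  one : n 1 = 1
  step : ∀ k, n (k + 2) = δ * n (k + 1) - n k
  ne_zero : ∀ k, n (k + 1) ≠ 0

/-- The Jones–Wenzl idempotent on the `k` strands in positions `i, …, i + k - 1`. -/
def wenzl (n : ℕ → K) (C D : ℕ → R) : ℕ → ℕ → R
  | _, 0 => 1
  | i, k + 1 => wenzl n C D (i + 1) k -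
      (n k / n (k + 1)) • (wenzl n C D (i + 1) k * (D i * C i) * wenzl n C D (i + 1) k)

/-- The nested cup of `r` arcs, innermost in position `a + r - 1`. -/
def nest (D : ℕ → R) (a : ℕ) : ℕ → R
  | 0 => 1
  | r + 1 => D (a + r) * nest D a r

/-- The nested cap of `r` arcs. -/
def conest (C : ℕ → R) (a : ℕ) : ℕ → R
  | 0 => 1
  | r + 1 => conest C a r * C (a + r)

/-- By the recursion, the left side is unchanged when one unit passes from y to x, so it can be
evaluated at y = 0. -/
theorem IsQuantumInt.mul_sub_mul {δ : K} {n : ℕ → K} (hn : IsQuantumInt δ n) (x y : ℕ) :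
    n (x + 1) * n (y + 1) - n x * n y = n (x + y + 1) := by
  induction y generalizing x with
  | zero => simp [hn.zero, hn.one]
  | succ y ih =>
    have h := ih (x + 1)
    rw [show x + (y + 1) + 1 = x + 1 + y + 1 by omega, ← h, show y + 1 + 1 = y + 2 from rfl,
      hn.step y, show x + 1 + 1 = x + 2 from rfl, hn.step x]
    ring

variable {δ : K} {n : ℕ → K} {C D : ℕ → R}

theorem wenzl_succ (i k : ℕ) : wenzl n C D i (k + 1) = wenzl n C D (i + 1) k -
    (n k / n (k + 1)) • (wenzl n C D (i + 1) k * (D i * C i) * wenzl n C D (i + 1) k) := rfl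

/-- Reversing the multiplication exchanges caps and cups. -/
theorem CapCup.op (h : CapCup δ C D) :
    CapCup δ (fun i => MulOpposite.op (D i)) (fun i => MulOpposite.op (C i)) where
  loop i := by rw [← MulOpposite.op_mul, h.loop]; rfl
  zigzag_left i := by rw [← MulOpposite.op_mul, h.zigzag_right]; rfl
  zigzag_right i := by rw [← MulOpposite.op_mul, h.zigzag_left]; rfl
  cap_cup_add_two i j hij := by simp only [← MulOpposite.op_mul, h.cap_add_two_cup i j hij]
  cap_add_two_cup i j hij := by simp only [← MulOpposite.op_mul, h.cap_cup_add_two i j hij]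
  cup_cup i j hij := by simp only [← MulOpposite.op_mul, h.cap_cap i j hij]
  cap_cap i j hij := by simp only [← MulOpposite.op_mul, h.cup_cup i j hij]

/-- The recursion is palindromic. With `CapCup.op`, every statement about caps on the left thus
yields its mirror image about cups on the right. -/
theorem wenzl_op (i k : ℕ) :
    wenzl n (fun i => MulOpposite.op (D i)) (fun i => MulOpposite.op (C i)) i k =
      MulOpposite.op (wenzl n C D i k) := by
  induction k generalizing i with
  | zero => rfl
  | succ k ih => simp only [wenzl_succ, ih, ← MulOpposite.op_mul, ← MulOpposite.op_smul,
      ← MulOpposite.op_sub, mul_assoc]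

namespace CapCup

/-- A cap to the left of the strands removes two positions, so everything to its right is renumbered
by two. -/
theorem cap_mul_wenzl_add_two (h : CapCup δ C D) {i j : ℕ} (hij : j ≤ i) (k : ℕ) :
    C j * wenzl n C D (i + 2) k = wenzl n C D i k * C j := by
  induction k generalizing i with
  | zero => simp [wenzl]
  | succ k ih =>
    have e := ih (i := i + 1) (by omega)
    have hD := h.cap_cup_add_two j i hij
    have hC := h.cap_cap j i hij
    simp only [wenzl_succ, mul_sub, sub_mul, mul_smul_comm, smul_mul_assoc,
      show i + 2 + 1 = i + 1 + 2 by omega, e]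
    congr 2
    calc C j * (wenzl n C D (i + 1 + 2) k * (D (i + 2) * C (i + 2)) * wenzl n C D (i + 1 + 2) k)
        = (C j * wenzl n C D (i + 1 + 2) k) * D (i + 2) * C (i + 2) *
            wenzl n C D (i + 1 + 2) k := by simp only [mul_assoc]
      _ = wenzl n C D (i + 1) k * (C j * D (i + 2)) * C (i + 2) *
            wenzl n C D (i + 1 + 2) k := by rw [e]; simp only [mul_assoc]
      _ = wenzl n C D (i + 1) k * D i * (C j * C (i + 2)) *
            wenzl n C D (i + 1 + 2) k := by rw [hD]; simp only [mul_assoc]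
      _ = wenzl n C D (i + 1) k * D i * C i * (C j * wenzl n C D (i + 1 + 2) k) := by
            rw [hC]; simp only [mul_assoc]
      _ = _ := by rw [e]; simp only [mul_assoc]

/-- Here the cap lies to the right of all the strands, which keep their positions. -/
theorem cap_mul_wenzl_of_le (h : CapCup δ C D) (hn : IsQuantumInt δ n) {i j k : ℕ}
    (hij : i + k ≤ j) : C j * wenzl n C D i k = wenzl n C D i k * C j := by
  induction k generalizing i with
  | zero => simp [wenzl]
  | succ k ih =>
    have e := ih (i := i + 1) (by omega)
    -- A single strand carries the identity, because [0] = 0. With two or more strands j ≥ 2, as the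
    -- exchange relations require.
    rcases k with _ | k
    · simp [wenzl, hn.zero]
    obtain ⟨j, rfl⟩ : ∃ j', j = j' + 2 := ⟨j - 2, by omega⟩
    have hD := h.cap_add_two_cup i j (by omega)
    have hC := h.cap_cap i j (by omega)
    rw [wenzl_succ]
    simp only [mul_sub, sub_mul, mul_smul_comm, smul_mul_assoc, e]
    congr 2
    set w := wenzl n C D (i + 1) (k + 1)
    calc C (j + 2) * (w * (D i * C i) * w)
        = (C (j + 2) * w) * D i * C i * w := by simp only [mul_assoc]
      _ = w * (C (j + 2) * D i) * C i * w := by rw [e]; simp only [mul_assoc]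
      _ = w * D i * (C j * C i) * w := by rw [hD]; simp only [mul_assoc]
      _ = w * D i * C i * (C (j + 2) * w) := by rw [← hC]; simp only [mul_assoc]
      _ = _ := by rw [e]; simp only [mul_assoc]

theorem wenzl_add_two_mul_cup (h : CapCup δ C D) {i j : ℕ} (hij : j ≤ i) (k : ℕ) :
    wenzl n C D (i + 2) k * D j = D j * wenzl n C D i k := by
  have := h.op.cap_mul_wenzl_add_two (n := n) hij k
  simpa only [wenzl_op, ← MulOpposite.op_mul, MulOpposite.op_inj] using this

theorem wenzl_mul_cup_of_le (h : CapCup δ C D) (hn : IsQuantumInt δ n) {i j k : ℕ}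
    (hij : i + k ≤ j) : wenzl n C D i k * D j = D j * wenzl n C D i k := by
  have := h.op.cap_mul_wenzl_of_le hn hij
  simpa only [wenzl_op, ← MulOpposite.op_mul, MulOpposite.op_inj] using this

/-- Jones–Wenzl idempotents on disjoint sets of strands commute. -/
theorem wenzl_comm (h : CapCup δ C D) (hn : IsQuantumInt δ n) {i k j : ℕ} (hij : i + k ≤ j)
    (l : ℕ) : Commute (wenzl n C D i k) (wenzl n C D j l) := by
  induction l generalizing j with
  | zero => exact Commute.one_right _
  | succ l ih =>
    have e := ih (j := j + 1) (by omega)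
    have hC : Commute (wenzl n C D i k) (C j) := (h.cap_mul_wenzl_of_le hn hij).symm
    have hD : Commute (wenzl n C D i k) (D j) := h.wenzl_mul_cup_of_le hn hij
    exact e.sub_right (((e.mul_right (hD.mul_right hC)).mul_right e).smul_right _)

end CapCup

/-- The idempotent is 1 plus terms whose rightmost non-trivial factor is a cap inside the strands,
and each such cap kills x. -/
theorem wenzl_mul_eq_self {i k : ℕ} {x : R} (hx : ∀ j, i ≤ j → j + 2 ≤ i + k → C j * x = 0)
    (hn : IsQuantumInt δ n) : wenzl n C D i k * x = x := by
  induction k generalizing i with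
  | zero => simp [wenzl]
  | succ k ih =>
    have e := ih (i := i + 1) fun j h1 h2 => hx j (by omega) (by omega)
    rcases k with _ | k
    · simp [wenzl, hn.zero]
    · rw [wenzl_succ, sub_mul, smul_mul_assoc, mul_assoc, e, mul_assoc, mul_assoc,
        hx i le_rfl (by omega)]
      simp

theorem mul_wenzl_eq_self (hn : IsQuantumInt δ n) {i k : ℕ} {x : R}
    (hx : ∀ j, i ≤ j → j + 2 ≤ i + k → x * D j = 0) : x * wenzl n C D i k = x := by
  have := wenzl_mul_eq_self (C := fun i => MulOpposite.op (D i))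
    (D := fun i => MulOpposite.op (C i)) (i := i) (k := k) (x := MulOpposite.op x)
    (fun j h1 h2 => by rw [← MulOpposite.op_mul, hx j h1 h2, MulOpposite.op_zero]) hn
  simpa only [wenzl_op, ← MulOpposite.op_mul, MulOpposite.op_inj] using this

namespace CapCup

/-- The recursion gives the coefficient δ - [k]/[k+1] = [k+2]/[k+1]. Idempotence is a hypothesis
because this is used inside the induction that establishes it. -/
theorem leftTrace_of_idem (h : CapCup δ C D) (hn : IsQuantumInt δ n) {i k : ℕ}
    (hp : wenzl n C D i k * wenzl n C D i k = wenzl n C D i k) :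
    C i * wenzl n C D (i + 1) (k + 1) * D i = (n (k + 2) / n (k + 1)) • wenzl n C D i k := by
  have e1 := h.cap_mul_wenzl_add_two (n := n) (le_refl i) k
  have e2 := h.wenzl_add_two_mul_cup (n := n) (le_refl i) k
  have e3 : C i * (wenzl n C D (i + 2) k * (D (i + 1) * C (i + 1)) * wenzl n C D (i + 2) k) * D i
      = wenzl n C D i k := by
    calc _ = (C i * wenzl n C D (i + 2) k) * D (i + 1) * C (i + 1) *
              (wenzl n C D (i + 2) k * D i) := by simp only [mul_assoc]
      _ = wenzl n C D i k * (C i * D (i + 1)) * (C (i + 1) * D i) * wenzl n C D i k := by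
              rw [e1, e2]; simp only [mul_assoc]
      _ = _ := by rw [h.zigzag_left, h.zigzag_right, mul_one, mul_one, hp]
  have e4 : C i * wenzl n C D (i + 2) k * D i = δ • wenzl n C D i k := by
    rw [e1, mul_assoc, h.loop, ← Algebra.commutes, Algebra.smul_def]
  rw [wenzl_succ, mul_sub, sub_mul, mul_smul_comm, smul_mul_assoc, e3, e4, ← sub_smul, hn.step]
  congr 1
  field_simp [hn.ne_zero k]

/-- Caps away from the left end already kill the shorter idempotent in the recursion. For the
leftmost cap, the partial trace turns the correction term into a copy of the main term, and the
coefficients cancel. -/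
theorem cap_mul_wenzl (h : CapCup δ C D) (hn : IsQuantumInt δ n) {i j k : ℕ} (hij : i ≤ j)
    (hjk : j + 2 ≤ i + k) : C j * wenzl n C D i k = 0 := by
  induction k using Nat.strong_induction_on generalizing i j with
  | _ k ih =>
    rcases k with _ | _ | k
    · omega
    · omega
    have key : ∀ j, i + 1 ≤ j → j + 2 ≤ i + 1 + (k + 1) →
        C j * wenzl n C D (i + 1) (k + 1) = 0 := fun j h1 h2 => ih (k + 1) (by omega) h1 h2
    rw [wenzl_succ, mul_sub, mul_smul_comm]
    rcases hij.eq_or_lt with rfl | hlt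
    · have hp : wenzl n C D i k * wenzl n C D i k = wenzl n C D i k :=
        wenzl_mul_eq_self (fun j h1 h2 => ih k (by omega) h1 h2) hn
      have ht := h.leftTrace_of_idem hn hp
      have e1 : wenzl n C D i k * (C i * wenzl n C D (i + 1) (k + 1)) =
          C i * wenzl n C D (i + 1) (k + 1) := by
        rw [← mul_assoc, ← h.cap_mul_wenzl_add_two (le_refl i), mul_assoc, wenzl_mul_eq_self
          (fun j h1 h2 => key j (by omega) (by omega)) hn]
      have e2 : C i * (wenzl n C D (i + 1) (k + 1) * (D i * C i) * wenzl n C D (i + 1) (k + 1)) =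
          (n (k + 2) / n (k + 1)) • (C i * wenzl n C D (i + 1) (k + 1)) := by
        calc _ = (C i * wenzl n C D (i + 1) (k + 1) * D i) *
              (C i * wenzl n C D (i + 1) (k + 1)) := by simp only [mul_assoc]
          _ = _ := by rw [ht, smul_mul_assoc, e1]
      have h1 := hn.ne_zero k
      have h2 := hn.ne_zero (k + 1)
      rw [e2, smul_smul, div_mul_div_cancel₀ h2, div_self h1, one_smul, sub_self]
    · have e := key j hlt (by omega)
      simp only [← mul_assoc, e, zero_mul, smul_zero, sub_zero]

theorem wenzl_mul_cup (h : CapCup δ C D) (hn : IsQuantumInt δ n) {i j k : ℕ} (hij : i ≤ j)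
    (hjk : j + 2 ≤ i + k) : wenzl n C D i k * D j = 0 := by
  have := h.op.cap_mul_wenzl hn hij hjk
  simpa only [wenzl_op, ← MulOpposite.op_mul, MulOpposite.op_eq_zero_iff] using this

/-- Caps inside the smaller range also lie inside the larger one. Equal ranges give idempotence. -/
theorem wenzl_absorb (h : CapCup δ C D) (hn : IsQuantumInt δ n) {i k i' k' : ℕ} (hi : i' ≤ i)
    (hk : i + k ≤ i' + k') : wenzl n C D i k * wenzl n C D i' k' = wenzl n C D i' k' :=
  wenzl_mul_eq_self (fun _ h1 h2 => h.cap_mul_wenzl hn (by omega) (by omega)) hn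

theorem wenzl_absorb' (h : CapCup δ C D) (hn : IsQuantumInt δ n) {i k i' k' : ℕ} (hi : i' ≤ i)
    (hk : i + k ≤ i' + k') : wenzl n C D i' k' * wenzl n C D i k = wenzl n C D i' k' := by
  have := h.op.wenzl_absorb hn hi hk
  simpa only [wenzl_op, ← MulOpposite.op_mul, MulOpposite.op_inj] using this

/-- The Wenzl recursion on the right, from the value of the partial trace on the right. -/
theorem wenzl_succ_right_of_trace (h : CapCup δ C D) (hn : IsQuantumInt δ n) {i k : ℕ}
    (ht : C (i + k) * wenzl n C D i (k + 1) * D (i + k) =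
      (n (k + 2) / n (k + 1)) • wenzl n C D i k) :
    wenzl n C D i (k + 2) = wenzl n C D i (k + 1) - (n (k + 1) / n (k + 2)) •
      (wenzl n C D i (k + 1) * (D (i + k) * C (i + k)) * wenzl n C D i (k + 1)) := by
  -- The candidate q is identified by computing its product with the idempotent on k + 2 strands in
  -- two ways: caps kill that idempotent on the left, and cups kill q on the right.
  set q := wenzl n C D i (k + 1) - (n (k + 1) / n (k + 2)) •
      (wenzl n C D i (k + 1) * (D (i + k) * C (i + k)) * wenzl n C D i (k + 1)) with hq
  have h1 := hn.ne_zero k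
  have h2 := hn.ne_zero (k + 1)
  have e1 : q * wenzl n C D i (k + 2) = wenzl n C D i (k + 2) := by
    rw [hq, sub_mul, smul_mul_assoc, mul_assoc, h.wenzl_absorb hn le_rfl (by omega), mul_assoc,
      mul_assoc, h.cap_mul_wenzl hn (by omega) (by omega)]
    simp
  have e2 : q * wenzl n C D i (k + 2) = q := by
    refine mul_wenzl_eq_self hn fun j hj1 hj2 => ?_
    rw [hq, sub_mul, smul_mul_assoc]
    rcases (show j ≤ i + k by omega).eq_or_lt with rfl | hlt
    · have e3 : wenzl n C D i (k + 1) * D (i + k) * wenzl n C D i k =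
          wenzl n C D i (k + 1) * D (i + k) := by
        rw [mul_assoc, ← h.wenzl_mul_cup_of_le hn le_rfl, ← mul_assoc,
          h.wenzl_absorb' hn le_rfl (by omega)]
      have e4 : wenzl n C D i (k + 1) * (D (i + k) * C (i + k)) * wenzl n C D i (k + 1) *
          D (i + k) = (n (k + 2) / n (k + 1)) • (wenzl n C D i (k + 1) * D (i + k)) := by
        calc _ = wenzl n C D i (k + 1) * D (i + k) *
              (C (i + k) * wenzl n C D i (k + 1) * D (i + k)) := by simp only [mul_assoc]
          _ = _ := by rw [ht, mul_smul_comm, e3]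
      rw [e4, smul_smul, div_mul_div_cancel₀ h2, div_self h1, one_smul, sub_self]
    · have e := h.wenzl_mul_cup hn (i := i) (j := j) (k := k + 1) hj1 (by omega)
      rw [mul_assoc, e]
      simp
  rw [← e1, e2]

/-- The trace over k + 1 strands gives the right-hand recursion for k + 2 strands, which in turn
gives the next trace, with coefficient δ - [k+1]/[k+2]. -/
theorem rightTrace (h : CapCup δ C D) (hn : IsQuantumInt δ n) (i k : ℕ) :
    C (i + k) * wenzl n C D i (k + 1) * D (i + k) = (n (k + 2) / n (k + 1)) • wenzl n C D i k := by
  induction k with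
  | zero =>
    have : n 2 = δ := by rw [hn.step 0, hn.one, hn.zero]; ring
    simp [wenzl, hn.zero, hn.one, h.loop, this, Algebra.algebraMap_eq_smul_one]
  | succ k ih =>
    set w := wenzl n C D i (k + 1) with hw
    have hidem : w * w = w := h.wenzl_absorb hn le_rfl le_rfl
    have e1 : C (i + (k + 1)) * w = w * C (i + (k + 1)) := h.cap_mul_wenzl_of_le hn le_rfl
    have e2 : w * D (i + (k + 1)) = D (i + (k + 1)) * w := h.wenzl_mul_cup_of_le hn le_rfl
    have e3 : C (i + (k + 1)) * (w * (D (i + k) * C (i + k)) * w) * D (i + (k + 1)) = w := by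
      calc _ = (C (i + (k + 1)) * w) * D (i + k) * C (i + k) * (w * D (i + (k + 1))) := by
              simp only [mul_assoc]
        _ = w * (C (i + (k + 1)) * D (i + k)) * (C (i + k) * D (i + (k + 1))) * w := by
              rw [e1, e2]; simp only [mul_assoc]
        _ = _ := by
              rw [← add_assoc, h.zigzag_left, h.zigzag_right, mul_one, mul_one, hidem]
    have e4 : C (i + (k + 1)) * w * D (i + (k + 1)) = δ • w := by
      rw [e1, mul_assoc, h.loop, ← Algebra.commutes, Algebra.smul_def]
    rw [h.wenzl_succ_right_of_trace hn ih, mul_sub, sub_mul, mul_smul_comm, smul_mul_assoc, e3,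
      e4, ← sub_smul, hn.step (k + 1)]
    congr 1
    field_simp [hn.ne_zero (k + 1)]

theorem wenzl_succ_right (h : CapCup δ C D) (hn : IsQuantumInt δ n) (i k : ℕ) :
    wenzl n C D i (k + 1) = wenzl n C D i k - (n k / n (k + 1)) •
      (wenzl n C D i k * (D (i + k - 1) * C (i + k - 1)) * wenzl n C D i k) := by
  -- For k = 0 the truncated position i + k - 1 is harmless: its coefficient contains [0].
  rcases k with _ | k
  · simp [wenzl, hn.zero]
  · exact h.wenzl_succ_right_of_trace hn (h.rightTrace hn i k)

/-- Contracting the last strand of `p_{s+1}` with the first strand of `p_{t+1}`. -/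
theorem cap_mul_wenzl_mul_wenzl_mul_cup (h : CapCup δ C D) (hn : IsQuantumInt δ n) (s t : ℕ) :
    C s * (wenzl n C D 0 (s + 1) * wenzl n C D (s + 1) (t + 1)) * D s =
      (n (s + 2) / n (s + 1) - n t / n (t + 1)) • (wenzl n C D 0 s * wenzl n C D s t) +
      (n s * n t / (n (s + 1) * n (t + 1))) • (wenzl n C D 0 s * wenzl n C D s t *
        (D (s - 1) * C (s - 1)) * (wenzl n C D 0 s * wenzl n C D s t)) := by
  set P := wenzl n C D 0 (s + 1) with hP
  set x := wenzl n C D 0 s with hx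
  set y := wenzl n C D s t with hy
  set z := wenzl n C D (s + 2) t with hz
  have cxy : x * y = y * x := h.wenzl_comm hn (by omega) t
  have cPz : P * z = z * P := h.wenzl_comm hn (by omega) t
  have hyy : y * y = y := h.wenzl_absorb hn le_rfl le_rfl
  have hC : C s * z = y * C s := h.cap_mul_wenzl_add_two le_rfl t
  have hD : z * D s = D s * y := h.wenzl_add_two_mul_cup le_rfl t
  have hPD : P * D (s + 1) = D (s + 1) * P := h.wenzl_mul_cup_of_le hn (by omega)
  have ht : C s * P * D s = (n (s + 2) / n (s + 1)) • x := by
    simpa using h.rightTrace hn 0 s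
  -- Main term of the left recursion for the second idempotent: only the first one feels the
  -- contraction, through its right trace.
  have first : C s * (P * z) * D s = (n (s + 2) / n (s + 1)) • (x * y) := by
    calc _ = C s * P * (z * D s) := by simp only [mul_assoc]
      _ = (C s * P * D s) * y := by rw [hD]; simp only [mul_assoc]
      _ = _ := by rw [ht, smul_mul_assoc]
  have hr : P = x - (n s / n (s + 1)) • (x * (D (s - 1) * C (s - 1)) * x) := by
    simpa using h.wenzl_succ_right hn 0 s
  -- Correction term: two zigzags straighten the strand and leave the first idempotent itself, which
  -- the right-hand recursion then expands.
  have second : C s * (P * (z * (D (s + 1) * C (s + 1)) * z)) * D s =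
      x * y - (n s / n (s + 1)) • (x * y * (D (s - 1) * C (s - 1)) * (x * y)) := by
    calc _ = C s * (P * z) * D (s + 1) * C (s + 1) * (z * D s) := by simp only [mul_assoc]
      _ = (C s * z) * (P * D (s + 1)) * (C (s + 1) * D s) * y := by
            rw [cPz, hD]; simp only [mul_assoc]
      _ = y * (C s * D (s + 1)) * P * (C (s + 1) * D s) * y := by
            rw [hC, hPD]; simp only [mul_assoc]
      _ = y * P * y := by rw [h.zigzag_left, h.zigzag_right, mul_one, mul_one]
      _ = y * x * y - (n s / n (s + 1)) • ((y * x) * (D (s - 1) * C (s - 1)) * (x * y)) := by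
            rw [hr, mul_sub, sub_mul, mul_smul_comm, smul_mul_assoc]; simp only [mul_assoc]
      _ = _ := by rw [← cxy, mul_assoc x y y, hyy]
  rw [wenzl_succ (s + 1) t, mul_sub, mul_smul_comm, mul_sub, sub_mul, mul_smul_comm,
    smul_mul_assoc, first, second, smul_sub, smul_smul, sub_smul, mul_comm (n s) (n t),
    mul_comm (n (s + 1)), mul_div_mul_comm]
  abel

/-- Capping the innermost arc of a three-vertex rescales it to the one with an arc less. -/
theorem cap_mul_vertex (h : CapCup δ C D) (hn : IsQuantumInt δ n) (a b : ℕ) (d : ℕ → K)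
    (d0 : d 0 = 0)
    (hd : ∀ r, d (r + 1) = n (a + r + 2) / n (a + r + 1) - n (b + r) / n (b + r + 1) +
      n (a + r) * n (b + r) / (n (a + r + 1) * n (b + r + 1)) * d r) (r : ℕ) :
    C (a + r) * (wenzl n C D 0 (a + r + 1) * wenzl n C D (a + r + 1) (b + r + 1) *
        (nest D a (r + 1) * wenzl n C D 0 (a + b))) =
      d (r + 1) • (wenzl n C D 0 (a + r) * wenzl n C D (a + r) (b + r) *
        (nest D a r * wenzl n C D 0 (a + b))) := by
  have key := h.cap_mul_wenzl_mul_wenzl_mul_cup hn (a + r) (b + r)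
  set p := wenzl n C D 0 (a + b) with hp
  have step : C (a + r) * (wenzl n C D 0 (a + r + 1) * wenzl n C D (a + r + 1) (b + r + 1) *
        (nest D a (r + 1) * p)) = (C (a + r) * (wenzl n C D 0 (a + r + 1) *
        wenzl n C D (a + r + 1) (b + r + 1)) * D (a + r)) * (nest D a r * p) := by
    simp only [nest, mul_assoc]
  rw [step, key, add_mul, smul_mul_assoc, smul_mul_assoc, hd, add_smul]
  congr 1
  rw [mul_smul]
  -- Only the coupling term remains. With no arcs it vanishes: its cap kills p, and if a or b is 0
  -- its coefficient contains [0]. Otherwise its cap acts on a vertex with one arc less, and the cup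
  -- that follows restores the arc.
  induction r with
  | zero =>
    rw [d0, zero_smul, smul_zero]
    rcases a with _ | a
    · simp [hn.zero]
    rcases b with _ | b
    · simp [hn.zero]
    have e1 : wenzl n C D (a + 1) (b + 1) * p = p := h.wenzl_absorb hn (by omega) (by omega)
    have e2 : wenzl n C D 0 (a + 1) * p = p := h.wenzl_absorb hn (by omega) (by omega)
    have e3 : C a * p = 0 := h.cap_mul_wenzl hn (by omega) (by omega)
    simp [nest, mul_assoc, e1, e2, e3]
  | succ r ih =>
    have key' := h.cap_mul_wenzl_mul_wenzl_mul_cup hn (a + r) (b + r)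
    have step' : C (a + r) * (wenzl n C D 0 (a + r + 1) * wenzl n C D (a + r + 1) (b + r + 1) *
        (nest D a (r + 1) * p)) = (C (a + r) * (wenzl n C D 0 (a + r + 1) *
        wenzl n C D (a + r + 1) (b + r + 1)) * D (a + r)) * (nest D a r * p) := by
      simp only [nest, mul_assoc]
    -- The full contraction identity at the previous stage, recovered from the coupling term
    -- supplied by the induction hypothesis.
    have main : C (a + r) * (wenzl n C D 0 (a + r + 1) * wenzl n C D (a + r + 1) (b + r + 1) *
        (nest D a (r + 1) * p)) = d (r + 1) • (wenzl n C D 0 (a + r) *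
        wenzl n C D (a + r) (b + r) * (nest D a r * p)) := by
      rw [step', key', add_mul, smul_mul_assoc, smul_mul_assoc, hd, add_smul]
      congr 1
      rw [mul_smul]
      exact ih key' step'
    set P := wenzl n C D 0 (a + r + 1) with hP
    set Q := wenzl n C D (a + r + 1) (b + r + 1) with hQ
    have e1 : D (a + r) * wenzl n C D 0 (a + r) = wenzl n C D 0 (a + r) * D (a + r) :=
      (h.wenzl_mul_cup_of_le hn (by omega)).symm
    have e2 : D (a + r) * wenzl n C D (a + r) (b + r) = wenzl n C D (a + r + 2) (b + r) * D (a + r) :=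
      (h.wenzl_add_two_mul_cup le_rfl _).symm
    have e3 : P * wenzl n C D 0 (a + r) = P := h.wenzl_absorb' hn le_rfl (by omega)
    have e4 : Q * wenzl n C D (a + r + 2) (b + r) = Q := h.wenzl_absorb' hn (by omega) (by omega)
    have e5 : Q * wenzl n C D 0 (a + r) = wenzl n C D 0 (a + r) * Q :=
      (h.wenzl_comm hn (by omega) _).symm
    show (n (a + r + 1) * n (b + r + 1) / (n (a + r + 1 + 1) * n (b + r + 1 + 1))) •
      (P * Q * (D (a + r) * C (a + r)) * (P * Q) * (nest D a (r + 1) * p)) = _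
    congr 1
    calc P * Q * (D (a + r) * C (a + r)) * (P * Q) * (nest D a (r + 1) * p)
        = P * Q * D (a + r) * (C (a + r) * (P * Q * (nest D a (r + 1) * p))) := by
          simp only [mul_assoc]
      _ = d (r + 1) • (P * Q * (D (a + r) * wenzl n C D 0 (a + r)) *
            wenzl n C D (a + r) (b + r) * (nest D a r * p)) := by
          rw [main, mul_smul_comm]; simp only [mul_assoc]
      _ = d (r + 1) • (P * (Q * wenzl n C D 0 (a + r)) * (D (a + r) *
            wenzl n C D (a + r) (b + r)) * (nest D a r * p)) := by
          rw [e1]; simp only [mul_assoc]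
      _ = d (r + 1) • ((P * wenzl n C D 0 (a + r)) * (Q * wenzl n C D (a + r + 2) (b + r)) *
            (D (a + r) * nest D a r * p)) := by
          rw [e5, e2]; simp only [mul_assoc]
      _ = _ := by rw [e3, e4]; rfl

/-- The value of the bubble `V* V` for the three-vertex `V` with `r` nested arcs. -/
theorem bubble (h : CapCup δ C D) (hn : IsQuantumInt δ n) (a b : ℕ) (d : ℕ → K)
    (d0 : d 0 = 0)
    (hd : ∀ r, d (r + 1) = n (a + r + 2) / n (a + r + 1) - n (b + r) / n (b + r + 1) +
      n (a + r) * n (b + r) / (n (a + r + 1) * n (b + r + 1)) * d r) (r : ℕ) :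
    wenzl n C D 0 (a + b) * (conest C a r * (wenzl n C D 0 (a + r) *
        wenzl n C D (a + r) (b + r) * (nest D a r * wenzl n C D 0 (a + b)))) =
      (∏ i ∈ Finset.range r, d (i + 1)) • wenzl n C D 0 (a + b) := by
  induction r with
  | zero =>
    simp only [nest, conest, one_mul, add_zero, Finset.range_zero, Finset.prod_empty, one_smul,
      mul_assoc]
    rw [h.wenzl_absorb hn (by omega) (by omega), h.wenzl_absorb hn (by omega) (by omega),
      h.wenzl_absorb hn (by omega) (by omega)]
  | succ r ih =>
    have e := h.cap_mul_vertex hn a b d d0 hd r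
    rw [Finset.prod_range_succ, mul_comm, mul_smul, ← ih, conest, mul_assoc (conest C a r)]
    simp only [← add_assoc]
    rw [e, mul_smul_comm, mul_smul_comm]

end CapCup
end TemperleyLieb
-- Realisation of the calculus on functions of infinite words.
section InfiniteWords

variable {N : ℕ}

/-- Functions on infinite words; operators on `H₁^{⊗k}` act on them through any `k` consecutive
letters. -/
abbrev InfTensor (N : ℕ) : Type := (ℕ → Fin N) → ℂ

/-- Insert the letters `x x` in positions `j, j + 1`. -/
def insertPair (j : ℕ) (x : Fin N) (w : ℕ → Fin N) : ℕ → Fin N :=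
  fun n => if n < j then w n else if n < j + 2 then x else w (n - 2)

/-- Remove the letters in positions `j, j + 1`. -/
def removePair (j : ℕ) (w : ℕ → Fin N) : ℕ → Fin N :=
  fun n => if n < j then w n else w (n + 2)

/-- `T₁*` in positions `j, j + 1`. -/
def capOp (N j : ℕ) : Module.End ℂ (InfTensor N) where
  toFun f w := ∑ x, f (insertPair j x w)
  map_add' f g := by ext w; simp [Finset.sum_add_distrib]
  map_smul' c f := by ext w; simp [Finset.mul_sum]

/-- `T₁` in positions `j, j + 1`. -/
def cupOp (N j : ℕ) : Module.End ℂ (InfTensor N) where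
  toFun f w := if w j = w (j + 1) then f (removePair j w) else 0
  map_add' f g := by ext w; simp only [Pi.add_apply]; split_ifs <;> simp
  map_smul' c f := by
    ext w; simp only [Pi.smul_apply, RingHom.id_apply]; split_ifs <;> simp

theorem capOp_apply (j : ℕ) (f : InfTensor N) (w : ℕ → Fin N) :
    capOp N j f w = ∑ x, f (insertPair j x w) := rfl

theorem cupOp_apply (j : ℕ) (f : InfTensor N) (w : ℕ → Fin N) :
    cupOp N j f w = if w j = w (j + 1) then f (removePair j w) else 0 := rfl

theorem removePair_insertPair_self (j : ℕ) (x : Fin N) (w : ℕ → Fin N) :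
    removePair j (insertPair j x w) = w := by
  funext n; simp only [removePair, insertPair]; split_ifs <;> first | rfl | omega

theorem insertPair_comm {i j : ℕ} (hij : i ≤ j) (x y : Fin N) (w : ℕ → Fin N) :
    insertPair (j + 2) y (insertPair i x w) = insertPair i x (insertPair j y w) := by
  funext n
  simp only [insertPair]
  split_ifs <;> first | rfl | omega

theorem removePair_comm {i j : ℕ} (hij : i ≤ j) (w : ℕ → Fin N) :
    removePair i (removePair (j + 2) w) = removePair j (removePair i w) := by
  funext n
  simp only [removePair]
  split_ifs <;> first | rfl | omega

theorem removePair_insertPair_of_le {i j : ℕ} (hij : i ≤ j) (x : Fin N) (w : ℕ → Fin N) :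
    removePair (j + 2) (insertPair i x w) = insertPair i x (removePair j w) := by
  funext n
  simp only [insertPair, removePair]
  split_ifs <;> first | rfl | omega | (congr 1; omega)

theorem removePair_insertPair_add_two {i j : ℕ} (hij : i ≤ j) (x : Fin N) (w : ℕ → Fin N) :
    removePair i (insertPair (j + 2) x w) = insertPair j x (removePair i w) := by
  funext n
  simp only [insertPair, removePair]
  split_ifs <;> first | rfl | omega | (congr 1; omega)

theorem removePair_succ_insertPair (i : ℕ) (w : ℕ → Fin N) :
    removePair (i + 1) (insertPair i (w i) w) = w := by
  funext n
  simp only [insertPair, removePair]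
  split_ifs <;> first | rfl | omega | (congr 1; omega)

theorem removePair_insertPair_succ (i : ℕ) (w : ℕ → Fin N) :
    removePair i (insertPair (i + 1) (w i) w) = w := by
  funext n
  simp only [insertPair, removePair]
  split_ifs <;> first | rfl | omega | (congr 1; omega)

theorem insertPair_of_lt {i n : ℕ} (h : n < i) (x : Fin N) (w : ℕ → Fin N) :
    insertPair i x w n = w n := by simp [insertPair, h]

theorem insertPair_of_mem {i n : ℕ} (h : i ≤ n) (h' : n < i + 2) (x : Fin N) (w : ℕ → Fin N) :
    insertPair i x w n = x := by simp [insertPair, h', not_lt.2 h]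

theorem insertPair_of_le {i n : ℕ} (h : i ≤ n) (x : Fin N) (w : ℕ → Fin N) :
    insertPair i x w (n + 2) = w n := by
  simp [insertPair, show ¬ n + 2 < i by omega, show ¬ n < i by omega]

/-- In the zigzags, the repeated letter is forced to equal the letter already at position i, so a
single summand survives. The loop counts the N letters. -/
theorem capCup_infTensor (N : ℕ) : CapCup (N : ℂ) (capOp N) (cupOp N) where
  loop i := by
    ext f w
    simp only [Module.End.mul_apply, capOp_apply, cupOp_apply]
    simp [insertPair_of_mem, removePair_insertPair_self]
  zigzag_left i := by
    ext f w
    simp only [Module.End.mul_apply, capOp_apply, cupOp_apply, Module.End.one_apply]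
    rw [Finset.sum_eq_single (w i)]
    · rw [insertPair_of_mem (n := i + 1) (by omega) (by omega), insertPair_of_le le_rfl,
        removePair_succ_insertPair, if_pos rfl]
    · intro x _ hx
      rw [insertPair_of_mem (n := i + 1) (by omega) (by omega), insertPair_of_le le_rfl,
        if_neg hx]
    · simp
  zigzag_right i := by
    ext f w
    simp only [Module.End.mul_apply, capOp_apply, cupOp_apply, Module.End.one_apply]
    rw [Finset.sum_eq_single (w i)]
    · rw [insertPair_of_mem (n := i + 1) (by omega) (by omega), insertPair_of_lt (by omega),
        removePair_insertPair_succ, if_pos rfl]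
    · intro x _ hx
      rw [insertPair_of_mem (n := i + 1) (by omega) (by omega), insertPair_of_lt (by omega),
        if_neg hx.symm]
    · simp
  cap_cup_add_two i j hij := by
    ext f w
    simp only [Module.End.mul_apply, capOp_apply, cupOp_apply, insertPair_of_le hij,
      show j + 2 + 1 = j + 1 + 2 by omega, insertPair_of_le (show i ≤ j + 1 by omega),
      removePair_insertPair_of_le hij]
    split_ifs <;> simp
  cap_add_two_cup i j hij := by
    ext f w
    simp only [Module.End.mul_apply, capOp_apply, cupOp_apply,
      insertPair_of_lt (show i < j + 2 by omega), insertPair_of_lt (show i + 1 < j + 2 by omega),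
      removePair_insertPair_add_two hij]
    split_ifs <;> simp
  cup_cup i j hij := by
    ext f w
    simp only [Module.End.mul_apply, cupOp_apply, removePair_comm hij]
    have e1 : removePair (j + 2) w i = w i := by simp [removePair, show i < j + 2 by omega]
    have e2 : removePair (j + 2) w (i + 1) = w (i + 1) := by
      simp [removePair, show i + 1 < j + 2 by omega]
    have e3 : removePair i w j = w (j + 2) := by simp [removePair, show ¬ j < i by omega]
    have e4 : removePair i w (j + 1) = w (j + 2 + 1) := by
      simp [removePair, show ¬ j + 1 < i by omega]
    rw [e1, e2, e3, e4]
    split_ifs <;> rfl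
  cap_cap i j hij := by
    ext f w
    simp only [Module.End.mul_apply, capOp_apply, insertPair_comm hij]
    exact Finset.sum_comm

/-! ### Matrices as operators on infinite words. -/

variable {ι κ μ : Type*}

/-- The operator on infinite tensors given by a matrix, through splittings of infinite words. -/
def wordOp [Fintype κ] (e : (ℕ → Fin N) ≃ ι × (ℕ → Fin N)) (e' : (ℕ → Fin N) ≃ κ × (ℕ → Fin N))
    (M : Matrix ι κ ℂ) : Module.End ℂ (InfTensor N) where
  toFun f w := ∑ v, M (e w).1 v * f (e'.symm (v, (e w).2))
  map_add' f g := by ext w; simp [mul_add, Finset.sum_add_distrib]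
  map_smul' c f := by ext w; simp [Finset.mul_sum, mul_left_comm]

section wordOp

variable (e : (ℕ → Fin N) ≃ ι × (ℕ → Fin N)) (e' : (ℕ → Fin N) ≃ κ × (ℕ → Fin N))
  (e'' : (ℕ → Fin N) ≃ μ × (ℕ → Fin N))

theorem wordOp_apply [Fintype κ] (M : Matrix ι κ ℂ) (f : InfTensor N) (w : ℕ → Fin N) :
    wordOp e e' M f w = ∑ v, M (e w).1 v * f (e'.symm (v, (e w).2)) := rfl

theorem wordOp_mul [Fintype κ] [Fintype μ] (M : Matrix ι κ ℂ) (M' : Matrix κ μ ℂ) :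
    wordOp e e'' (M * M') = wordOp e e' M * wordOp e' e'' M' := by
  ext f w
  simp only [Module.End.mul_apply, wordOp_apply, Matrix.mul_apply, Equiv.apply_symm_apply,
    Finset.sum_mul, Finset.mul_sum]
  rw [Finset.sum_comm]
  simp only [mul_assoc]

theorem wordOp_one [Fintype ι] [DecidableEq ι] : wordOp e e (1 : Matrix ι ι ℂ) = 1 := by
  ext f w
  simp [wordOp_apply, Matrix.one_apply]

theorem wordOp_sub [Fintype κ] (M M' : Matrix ι κ ℂ) :
    wordOp e e' (M - M') = wordOp e e' M - wordOp e e' M' := by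
  ext f w
  simp [wordOp_apply, sub_mul]

theorem wordOp_smul [Fintype κ] (c : ℂ) (M : Matrix ι κ ℂ) :
    wordOp e e' (c • M) = c • wordOp e e' M := by
  ext f w
  simp [wordOp_apply, Finset.mul_sum, mul_assoc]

/-- This brings identities back from the ring to matrices. Indicator functions of the split-off
letters recover the entries; a letter must exist to fill the tail of the word. -/
theorem wordOp_injective [Fintype κ] [Nonempty (Fin N)] : Function.Injective (wordOp e e') := by
  classical
  intro M M' h
  ext i j
  obtain ⟨x⟩ := ‹Nonempty (Fin N)›
  have := congrFun (LinearMap.congr_fun h fun w => if (e' w).1 = j then 1 else 0)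
    (e.symm (i, fun _ => x))
  simpa [wordOp_apply] using this

/-- When the columns of M are sums of basis vectors, the adjoint just sums f over substituted words;
caps have this form. -/
theorem wordOp_conjTranspose_apply [Fintype ι] [DecidableEq ι] {X : Type*} [Fintype X] {M : Matrix ι κ ℂ}
    (g : X → κ → ι) (hM : ∀ v u, M v u = ∑ x, if v = g x u then 1 else 0)
    (f : InfTensor N) (w : ℕ → Fin N) :
    wordOp e' e M.conjTranspose f w = ∑ x, f (e.symm (g x (e' w).1, (e' w).2)) := by
  simp only [wordOp_apply, Matrix.conjTranspose_apply, hM, star_sum, Finset.sum_mul]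
  rw [Finset.sum_comm]
  refine Finset.sum_congr rfl fun x _ => ?_
  simp [apply_ite]

end wordOp

/-- Split off the `k` letters in positions `i, …, i + k - 1`. -/
def splitAt (N i k : ℕ) : (ℕ → Fin N) ≃ Word N k × (ℕ → Fin N) where
  toFun w := (fun j => w (i + j), fun n => if n < i then w n else w (n + k))
  invFun p n := if n < i then p.2 n else if h : n - i < k then p.1 ⟨n - i, h⟩ else p.2 (n - k)
  left_inv w := by
    funext n
    simp only
    split_ifs <;> first | rfl | omega | (congr 1; omega)
  right_inv p := by
    refine Prod.ext (funext fun n => ?_) (funext fun n => ?_)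
    · simp
    · simp only
      split_ifs <;> first | rfl | omega | simp

/-- Split off the first `l` letters and the `m` letters that follow. -/
def splitPair (N l m : ℕ) : (ℕ → Fin N) ≃ (Word N l × Word N m) × (ℕ → Fin N) where
  toFun w := ((fun j => w j, fun j => w (l + j)), fun n => w (n + (l + m)))
  invFun p n := if h : n < l then p.1.1 ⟨n, h⟩ else
    if h : n - l < m then p.1.2 ⟨n - l, h⟩ else p.2 (n - (l + m))
  left_inv w := by
    funext n
    simp only
    split_ifs <;> first | rfl | omega | (congr 1; omega)
  right_inv p := by
    refine Prod.ext (Prod.ext (funext fun n => ?_) (funext fun n => ?_)) (funext fun n => ?_)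
    · simp
    · simp
    · simp only
      split_ifs <;> first | rfl | omega | simp

theorem wordOp_cupTensor (i k : ℕ) :
    wordOp (splitAt N i (k + 2)) (splitAt N i k) (cupTensor N k) = cupOp N i := by
  ext f w
  rw [wordOp_apply, cupOp_apply]
  by_cases h : w i = w (i + 1)
  · have h' : ((splitAt N i (k + 2)) w).1 0 = ((splitAt N i (k + 2)) w).1 1 := by
      simpa [splitAt] using h
    simp only [cupTensor, h', true_and, ite_mul, one_mul, zero_mul, Finset.sum_ite_eq,
      Finset.mem_univ, if_true, if_pos h]
    congr 1
    funext n
    simp only [splitAt, removePair, Equiv.coe_fn_mk, Equiv.coe_fn_symm_mk, Fin.tail]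
    split_ifs <;> first | rfl | omega | (congr 1; simp; omega) | (congr 1; omega)
  · have h' : ¬ ((splitAt N i (k + 2)) w).1 0 = ((splitAt N i (k + 2)) w).1 1 := by
      simpa [splitAt] using h
    simp [cupTensor, h', h]

theorem cupTensor_eq_sum (k : ℕ) (v : Word N (k + 2)) (u : Word N k) :
    cupTensor N k v u =
      ∑ x : Fin N, if v = Fin.cons x (Fin.cons x u : Word N (k + 1)) then 1 else 0 := by
  have : ∀ x : Fin N, v = Fin.cons x (Fin.cons x u : Word N (k + 1)) ↔
      v 0 = x ∧ (v 0 = v 1 ∧ Fin.tail (Fin.tail v) = u) := by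
    intro x
    constructor
    · rintro rfl
      exact ⟨rfl, rfl, rfl⟩
    · rintro ⟨rfl, h1, rfl⟩
      rw [show (Fin.cons (v 0) (Fin.tail (Fin.tail v)) : Word N (k + 1)) = Fin.tail v by
        rw [h1]; exact Fin.cons_self_tail (Fin.tail v)]
      exact (Fin.cons_self_tail v).symm
  simp only [this, ite_and, cupTensor, Finset.sum_ite_eq, Finset.mem_univ, if_true]

theorem splitAt_symm_cons (i k : ℕ) (v : Word N k) (w : ℕ → Fin N) :
    (splitAt N i (k + 1)).symm (Fin.cons (w i) v, (splitAt N i (k + 1) w).2) =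
      (splitAt N (i + 1) k).symm (v, (splitAt N (i + 1) k w).2) := by
  funext n
  simp only [splitAt, Equiv.coe_fn_mk, Equiv.coe_fn_symm_mk]
  rcases lt_trichotomy n i with h | rfl | h
  · simp [h, Nat.lt_succ_of_lt h]
  · simp
  · obtain ⟨n, rfl⟩ := Nat.exists_eq_add_of_lt h
    have e1 : i + n + 1 - i = n + 1 := by omega
    have e2 : i + n + 1 - (i + 1) = n := by omega
    simp only [e1, e2, show ¬ i + n + 1 < i by omega, show ¬ i + n + 1 < i + 1 by omega,
      if_false, add_lt_add_iff_right]
    split_ifs <;> first | rfl | omega | (congr 1; omega)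

theorem splitAt_symm_cons_cons (i k : ℕ) (x : Fin N) (w : ℕ → Fin N) (n : ℕ) :
    (splitAt N i (k + 2)).symm (Fin.cons x (Fin.cons x (splitAt N i k w).1 : Word N (k + 1)),
      (splitAt N i k w).2) n = insertPair i x w n := by
  simp only [splitAt, insertPair, Equiv.coe_fn_mk, Equiv.coe_fn_symm_mk]
  by_cases h1 : n < i
  · simp [h1]
  obtain ⟨n, rfl⟩ := Nat.exists_eq_add_of_le (not_lt.1 h1)
  rcases n with _ | _ | n
  · simp
  · rw [show i + (0 + 1) - i = 1 by omega]
    simp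
  · have e1 : i + (n + 2) - i = n + 2 := by omega
    have e2 : i + (n + 2) - 2 = i + n := by omega
    simp only [h1, e1, e2, if_false, show ¬ i + (n + 2) < i + 2 by omega, add_lt_add_iff_right]
    split_ifs <;> first | rfl | omega | (congr 1; omega)

theorem wordOp_cupTensor_conjTranspose (i k : ℕ) :
    wordOp (splitAt N i k) (splitAt N i (k + 2)) (cupTensor N k).conjTranspose = capOp N i := by
  ext f w
  rw [wordOp_conjTranspose_apply _ _ _ (cupTensor_eq_sum k), capOp_apply]
  refine Finset.sum_congr rfl fun x _ => ?_
  congr 1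
  funext n
  exact splitAt_symm_cons_cons i k x w n

/-- Tensoring with the identity on the left leaves the letter at position i alone; this is the shift
to i + 1 in the recursion for `wenzl`. -/
theorem wordOp_idTensor (i k : ℕ) (M : Matrix (Word N k) (Word N k) ℂ) :
    wordOp (splitAt N i (k + 1)) (splitAt N i (k + 1)) (idTensor M) =
      wordOp (splitAt N (i + 1) k) (splitAt N (i + 1) k) M := by
  ext f w
  rw [wordOp_apply, wordOp_apply, ← (Fin.consEquiv fun _ => Fin N).sum_comp, Fintype.sum_prod_type]
  rw [Finset.sum_eq_single (w i)]
  · refine Finset.sum_congr rfl fun v _ => ?_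
    congr 1
    · rw [idTensor, if_pos (by simp [splitAt, Fin.consEquiv])]
      congr 1
      funext j
      simp only [splitAt, Equiv.coe_fn_mk, Fin.tail, Fin.val_succ]
      congr 1
      omega
    · congr 1
      exact splitAt_symm_cons i k v w
  · intro x _ hx
    refine Finset.sum_eq_zero fun v _ => ?_
    rw [idTensor, if_neg, zero_mul]
    simpa [splitAt, Fin.consEquiv] using hx.symm
  · simp

theorem wordOp_kronecker (l m : ℕ) (A : Matrix (Word N l) (Word N l) ℂ)
    (B : Matrix (Word N m) (Word N m) ℂ) :
    wordOp (splitPair N l m) (splitPair N l m) (A ⊗ₖ B) =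
      wordOp (splitAt N 0 l) (splitAt N 0 l) A * wordOp (splitAt N l m) (splitAt N l m) B := by
  ext f w
  simp only [wordOp_apply, Module.End.mul_apply, Fintype.sum_prod_type, Finset.mul_sum]
  refine Finset.sum_congr rfl fun u _ => Finset.sum_congr rfl fun v _ => ?_
  rw [Matrix.kroneckerMap_apply, ← mul_assoc]
  congr 1
  · congr 2
    · funext j
      simp [splitPair, splitAt]
    · funext j
      simp [splitPair, splitAt, add_comm]
  · congr 1
    funext n
    simp only [splitPair, splitAt, Equiv.coe_fn_mk, Equiv.coe_fn_symm_mk]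
    split_ifs <;> first | rfl | omega | (congr 1; omega)

/-- The two recursions agree term by term. At k = 1 the abstract one still has a correction term,
with coefficient [0]/[1] = 0. -/
theorem wordOp_jonesWenzl (i k : ℕ) :
    wordOp (splitAt N i k) (splitAt N i k) (jonesWenzl N k) =
      wenzl (fun j => ((qInt (qParam N) j : ℝ) : ℂ)) (capOp N) (cupOp N) i k := by
  induction k generalizing i with
  | zero => exact wordOp_one _
  | succ k ih =>
    rcases k with _ | k
    · simp [jonesWenzl, wordOp_one, wenzl, qInt]
    · rw [jonesWenzl, wordOp_sub, wordOp_smul, wordOp_mul _ (splitAt N i (k + 2)),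
        wordOp_mul _ (splitAt N i (k + 2)), wordOp_mul _ (splitAt N i k),
        wordOp_idTensor, wordOp_cupTensor, wordOp_cupTensor_conjTranspose, ih, wenzl_succ]
      push_cast
      rfl

/-- `ι ⊗ T₁ ⊗ ι` on `H₁^{⊗l} ⊗ H₁^{⊗m}`, in the middle. -/
def cupPair (N l m : ℕ) : Matrix (Word N (l + 1) × Word N (m + 1)) (Word N l × Word N m) ℂ :=
  fun v u => if v.1 (Fin.last l) = v.2 0 ∧ (Fin.init v.1, Fin.tail v.2) = u then 1 else 0

theorem wordOp_cupPair (l m : ℕ) :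
    wordOp (splitPair N (l + 1) (m + 1)) (splitPair N l m) (cupPair N l m) = cupOp N l := by
  ext f w
  rw [wordOp_apply, cupOp_apply]
  have h' : ((splitPair N (l + 1) (m + 1)) w).1.1 (Fin.last l) =
      ((splitPair N (l + 1) (m + 1)) w).1.2 0 ↔ w l = w (l + 1) := by
    simp [splitPair]
  by_cases h : w l = w (l + 1)
  · simp only [cupPair, h', h, true_and, ite_mul, one_mul, zero_mul, Finset.sum_ite_eq,
      Finset.mem_univ, if_true]
    congr 1
    funext n
    simp only [splitPair, removePair, Equiv.coe_fn_mk, Equiv.coe_fn_symm_mk, Fin.tail, Fin.init]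
    split_ifs <;> first | rfl | omega | (congr 1; simp; omega) | (congr 1; omega)
  · simp only [cupPair, h', h, false_and, if_false, zero_mul, Finset.sum_const_zero]

theorem cupPair_eq_sum (l m : ℕ) (v : Word N (l + 1) × Word N (m + 1))
    (u : Word N l × Word N m) :
    cupPair N l m v u = ∑ x : Fin N, if v = ((Fin.snoc u.1 x : Word N (l + 1)),
      (Fin.cons x u.2 : Word N (m + 1))) then 1 else 0 := by
  have : ∀ x : Fin N, v = ((Fin.snoc u.1 x : Word N (l + 1)), (Fin.cons x u.2 : Word N (m + 1))) ↔
      v.2 0 = x ∧ (v.1 (Fin.last l) = v.2 0 ∧ (Fin.init v.1, Fin.tail v.2) = u) := by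
    intro x
    constructor
    · rintro rfl
      simp
    · obtain ⟨v1, v2⟩ := v
      rintro ⟨rfl, h1, rfl⟩
      simp only at h1 ⊢
      rw [Fin.cons_self_tail, ← h1, Fin.snoc_init_self]
  simp only [this, ite_and, cupPair, Finset.sum_ite_eq, Finset.mem_univ, if_true]

theorem wordOp_cupPair_conjTranspose (l m : ℕ) :
    wordOp (splitPair N l m) (splitPair N (l + 1) (m + 1)) (cupPair N l m).conjTranspose =
      capOp N l := by
  ext f w
  rw [wordOp_conjTranspose_apply _ _ _ (cupPair_eq_sum l m), capOp_apply]
  refine Finset.sum_congr rfl fun x _ => ?_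
  congr 1
  funext n
  simp only [splitPair, insertPair, Equiv.coe_fn_mk, Equiv.coe_fn_symm_mk]
  rcases lt_or_ge n l with h | h
  · simp [h, Nat.lt_succ_of_lt h, Fin.snoc]
  obtain ⟨n, rfl⟩ := Nat.exists_eq_add_of_le h
  rcases n with _ | _ | n
  · simp [Fin.snoc]
  · simp
  · have e1 : l + (n + 2) - (l + 1) = n + 1 := by omega
    have e2 : l + (n + 2) - 2 = l + n := by omega
    simp only [e1, e2, show ¬ l + (n + 2) < l by omega, show ¬ l + (n + 2) < l + 1 by omega,
      if_false, dite_false, show ¬ l + (n + 2) < l + 2 by omega, add_lt_add_iff_right]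
    split_ifs <;> first | rfl | omega | (congr 1; omega)

/-- The new arc is the innermost: it joins the last letter of the left word to the first of the
right word. Once it is removed, the three index conditions are those for r arcs. -/
theorem nestedCup_succ {k l m r : ℕ} (hl : r ≤ l) (hk : k + 2 * r = l + m) :
    nestedCup N k (l + 1) (m + 1) (r + 1) = cupPair N l m * nestedCup N k l m r := by
  ext ⟨v1, v2⟩ c
  simp only [Matrix.mul_apply, cupPair, ite_and, ite_mul, one_mul, zero_mul]
  by_cases h : v1 (Fin.last l) = v2 0
  · simp only [h, if_true, Finset.sum_ite_eq, Finset.mem_univ, nestedCup]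
    congr 1
    refine propext (and_congr ?_ (and_congr ?_ ?_))
    · constructor
      · exact fun H x y hx hy => H x.castSucc y (by simp; omega) (by simpa using hy)
      · exact fun H x y hx hy => H ⟨x, by omega⟩ y (by simp; omega) hy
    · constructor
      · exact fun H x y hx hy => H x.succ y (by simp; omega) (by simp; omega)
      · intro H x y hx hy
        obtain ⟨x, rfl⟩ := Fin.exists_succ_eq.2 (show x ≠ 0 by rintro rfl; simp at hx)
        simp only [Fin.val_succ] at hx hy
        exact H x y (by omega) (by omega)
    · constructor
      · exact fun H x y hx hy => H x.castSucc y.succ (by simp; omega) (by simp; omega)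
      · intro H x y hy hxy
        rcases Fin.eq_zero_or_eq_succ y with rfl | ⟨y, rfl⟩
        · rw [show x = Fin.last l from Fin.ext (by simpa using hxy), h]
        · simp only [Fin.val_succ] at hy hxy
          exact H ⟨x, by omega⟩ y (by omega) (by simp; omega)
  · simp only [h, if_false, Finset.sum_const_zero, nestedCup]
    rw [if_neg]
    rintro ⟨-, -, h3⟩
    exact h (h3 (Fin.last l) 0 (by simp) (by simp))

/-- Cut a word after its first `a` letters. -/
def cutWord (a b : ℕ) (u : Word N (a + b)) : Word N a × Word N b :=
  (fun j => u (Fin.castAdd b j), fun j => u (Fin.natAdd a j))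

theorem cutWord_injective (a b : ℕ) : Function.Injective (cutWord (N := N) a b) := by
  intro u u' h
  funext j
  refine Fin.addCases (fun j => ?_) (fun j => ?_) j
  · exact congrFun (congrArg Prod.fst h) j
  · exact congrFun (congrArg Prod.snd h) j

theorem nestedCup_zero (a b : ℕ) (v : Word N a × Word N b) (u : Word N (a + b)) :
    nestedCup N (a + b) a b 0 v u = if v = cutWord a b u then 1 else 0 := by
  rw [nestedCup]
  congr 1
  refine propext ⟨fun H => ?_, ?_⟩
  · refine Prod.ext (funext fun x => ?_) (funext fun x => ?_)
    · exact H.1 x (Fin.castAdd b x) (by simp) (by simp)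
    · exact H.2.1 x (Fin.natAdd a x) (by simp) (by simp)
  · rintro rfl
    refine ⟨fun x y _ hy => ?_, fun x y _ hy => ?_, fun x y h => by omega⟩
    · exact congrArg u (Fin.ext (by simpa using hy))
    · exact congrArg u (Fin.ext (by simpa using hy))

theorem cutWord_splitAt (a b : ℕ) (w : ℕ → Fin N) :
    cutWord a b (splitAt N 0 (a + b) w).1 = (splitPair N a b w).1 := by
  simp [cutWord, splitAt, splitPair]

theorem splitPair_symm_cutWord (a b : ℕ) (w : ℕ → Fin N) :
    (splitPair N a b).symm (cutWord a b (splitAt N 0 (a + b) w).1, (splitAt N 0 (a + b) w).2) =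
      w := by
  rw [cutWord_splitAt]
  exact (splitPair N a b).symm_apply_apply w

theorem wordOp_nestedCup_zero (a b : ℕ) :
    wordOp (splitPair N a b) (splitAt N 0 (a + b)) (nestedCup N (a + b) a b 0) = 1 := by
  ext f w
  rw [wordOp_apply, Finset.sum_eq_single (splitAt N 0 (a + b) w).1]
  · rw [nestedCup_zero, cutWord_splitAt, if_pos rfl, one_mul]
    exact congrArg f ((splitAt N 0 (a + b)).symm_apply_apply w)
  · intro u _ hu
    rw [nestedCup_zero, ← cutWord_splitAt, if_neg, zero_mul]
    exact fun h => hu (cutWord_injective a b h).symm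
  · simp

theorem wordOp_nestedCup_zero_conjTranspose (a b : ℕ) :
    wordOp (splitAt N 0 (a + b)) (splitPair N a b)
      (nestedCup N (a + b) a b 0).conjTranspose = 1 := by
  ext f w
  rw [wordOp_conjTranspose_apply _ _ (X := Unit) (fun _ => cutWord a b)
    fun v u => by rw [nestedCup_zero]; simp]
  simp [splitPair_symm_cutWord]

theorem wordOp_nestedCup (a b r : ℕ) :
    wordOp (splitPair N (a + r) (b + r)) (splitAt N 0 (a + b))
      (nestedCup N (a + b) (a + r) (b + r) r) = nest (cupOp N) a r := by
  induction r with
  | zero => exact wordOp_nestedCup_zero a b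
  | succ r ih =>
    rw [nest, ← ih, ← wordOp_cupPair (a + r) (b + r), ← wordOp_mul, ← nestedCup_succ] <;> first | rfl | omega

theorem wordOp_nestedCup_conjTranspose (a b r : ℕ) :
    wordOp (splitAt N 0 (a + b)) (splitPair N (a + r) (b + r))
      (nestedCup N (a + b) (a + r) (b + r) r).conjTranspose = conest (capOp N) a r := by
  induction r with
  | zero => exact wordOp_nestedCup_zero_conjTranspose a b
  | succ r ih =>
    rw [conest, ← ih, ← wordOp_cupPair_conjTranspose (a + r) (b + r), ← wordOp_mul,
      ← Matrix.conjTranspose_mul, ← nestedCup_succ] <;> first | rfl | omega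

end InfiniteWords
-- The parameter q, quantum integers and the arc factors.
section QuantumParameter

theorem qParam_eq {N : ℕ} (hN : 3 ≤ N) :
    qParam N = ((N : ℝ) - √((N : ℝ) ^ 2 - 4)) / 2 := by
  have h3 : (3 : ℝ) ≤ N := by exact_mod_cast hN
  have hN0 : (0 : ℝ) < N := by linarith
  have e : √(1 - 4 / (N : ℝ) ^ 2) = √((N : ℝ) ^ 2 - 4) / N := by
    rw [show (1 : ℝ) - 4 / (N : ℝ) ^ 2 = ((N : ℝ) ^ 2 - 4) / (N : ℝ) ^ 2 by field_simp,
      Real.sqrt_div' _ (by positivity), Real.sqrt_sq hN0.le]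
  have hs : √((N : ℝ) ^ 2 - 4) ^ 2 = (N : ℝ) ^ 2 - 4 := Real.sq_sqrt (by nlinarith)
  have hs0 := Real.sqrt_nonneg ((N : ℝ) ^ 2 - 4)
  rw [qParam, e]
  have : (N : ℝ) + √((N : ℝ) ^ 2 - 4) ≠ 0 := by positivity
  field_simp
  nlinarith

theorem qParam_pos {N : ℕ} (hN : 3 ≤ N) : 0 < qParam N := by
  have h3 : (3 : ℝ) ≤ N := by exact_mod_cast hN
  have : √((N : ℝ) ^ 2 - 4) < N := by
    rw [Real.sqrt_lt' (by linarith)]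
    linarith
  rw [qParam_eq hN]
  linarith

theorem qParam_lt_one {N : ℕ} (hN : 3 ≤ N) : qParam N < 1 := by
  have h3 : (3 : ℝ) ≤ N := by exact_mod_cast hN
  have : (N : ℝ) - 2 < √((N : ℝ) ^ 2 - 4) := by
    apply Real.lt_sqrt_of_sq_lt
    nlinarith
  rw [qParam_eq hN]
  linarith

/-- This is [2] = N: the quantum integers match the loop value of the caps and cups. -/
theorem qParam_add_inv {N : ℕ} (hN : 3 ≤ N) : qParam N + (qParam N)⁻¹ = N := by
  have h3 : (3 : ℝ) ≤ N := by exact_mod_cast hN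
  have hq := (qParam_pos hN).ne'
  have hs : √((N : ℝ) ^ 2 - 4) ^ 2 = (N : ℝ) ^ 2 - 4 := Real.sq_sqrt (by nlinarith)
  have h2 : qParam N * qParam N + 1 = N * qParam N := by
    rw [qParam_eq hN]
    nlinarith
  field_simp
  linarith

theorem qInt_eq {q : ℝ} (hq : q ≠ 0) (n : ℕ) :
    qInt q n = q * (q⁻¹ ^ n - q ^ n) / (1 - q ^ 2) := by
  rw [qInt, neg_sub, zpow_sub₀ hq, zpow_one, zpow_natCast, pow_mul', inv_pow]
  field_simp

theorem isQuantumInt_qInt {q : ℝ} (hq : 0 < q) (hq1 : q < 1) :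
    IsQuantumInt (q + q⁻¹) (qInt q) where
  zero := by simp [qInt]
  one := by
    have : 1 - q ^ 2 ≠ 0 := by nlinarith
    simp [qInt, this]
  step k := by
    have h : q * q⁻¹ = 1 := mul_inv_cancel₀ hq.ne'
    simp only [qInt_eq hq.ne', ← mul_div_assoc, ← sub_div]
    congr 1
    linear_combination (q * q ^ k - q * q⁻¹ ^ k) * h
  ne_zero k := by
    have h1 : q ^ 2 < 1 := by nlinarith
    have h2 : q ^ (2 * (k + 1)) < 1 := pow_lt_one₀ hq.le hq1 (by omega)
    have : 0 < qInt q (k + 1) := by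
      rw [qInt]
      have := sub_pos.2 h1
      have := sub_pos.2 h2
      positivity
    exact this.ne'

theorem qInt_pos {q : ℝ} (hq : 0 < q) (hq1 : q < 1) (k : ℕ) : 0 < qInt q (k + 1) := by
  have h1 : q ^ 2 < 1 := by nlinarith
  have h2 : q ^ (2 * (k + 1)) < 1 := pow_lt_one₀ hq.le hq1 (by omega)
  rw [qInt]
  have := sub_pos.2 h1
  have := sub_pos.2 h2
  positivity

theorem isQuantumInt_qParam {N : ℕ} (hN : 3 ≤ N) :
    IsQuantumInt (N : ℝ) (qInt (qParam N)) := by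
  rw [← qParam_add_inv hN]
  exact isQuantumInt_qInt (qParam_pos hN) (qParam_lt_one hN)

theorem isQuantumInt_qParam_complex {N : ℕ} (hN : 3 ≤ N) :
    IsQuantumInt (N : ℂ) (fun k => ((qInt (qParam N) k : ℝ) : ℂ)) where
  zero := by simp [(isQuantumInt_qParam hN).zero]
  one := by simp [(isQuantumInt_qParam hN).one]
  step k := by rw [(isQuantumInt_qParam hN).step]; push_cast; rfl
  ne_zero k := by exact_mod_cast (isQuantumInt_qParam hN).ne_zero k

/-- The factor by which removing the `r`-th arc scales a bubble. -/
def arcFactor {K : Type*} [Field K] (n : ℕ → K) (a b r : ℕ) : K :=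
  n r * n (a + b + r + 1) / (n (a + r) * n (b + r))

/-- After clearing denominators, this says that [a+r+2][b+r+1] - [a+r+1][b+r] and [r+1][a+b+r+2] -
[r][a+b+r+1] agree: both are [a+b+2r+2]. -/
theorem arcFactor_succ {K : Type*} [Field K] {δ : K} {n : ℕ → K} (hn : IsQuantumInt δ n)
    (a b r : ℕ) : arcFactor n a b (r + 1) =
      n (a + r + 2) / n (a + r + 1) - n (b + r) / n (b + r + 1) +
      n (a + r) * n (b + r) / (n (a + r + 1) * n (b + r + 1)) * arcFactor n a b r := by
  have ha := hn.ne_zero (a + r)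
  have hb := hn.ne_zero (b + r)
  have h1 := hn.mul_sub_mul (a + r + 1) (b + r)
  have h2 := hn.mul_sub_mul r (a + b + r + 1)
  have e : n (a + r) * n (b + r) * arcFactor n a b r = n r * n (a + b + r + 1) := by
    -- At r = 0 the denominator [a][b] may vanish, but both sides contain [0].
    rcases r with _ | r
    · simp [arcFactor, hn.zero]
    · have := hn.ne_zero (a + r)
      have := hn.ne_zero (b + r)
      rw [arcFactor, ← add_assoc a, ← add_assoc b]
      field_simp
  rw [div_mul_eq_mul_div, e]
  simp only [arcFactor, ← add_assoc]
  rw [show a + b + r + 1 + 1 = a + b + r + 2 from rfl] at *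
  have h3 : a + r + 1 + (b + r) + 1 = r + (a + b + r + 1) + 1 := by omega
  rw [h3, ← h2] at h1
  field_simp
  linear_combination (-1 : K) * h1

end QuantumParameter

/-! ### Jones–Wenzl matrices: projections, traces and the bubble identity. -/

section Matrices

variable {N : ℕ}

theorem conjTranspose_idTensor {k : ℕ} (M : Matrix (Word N k) (Word N k) ℂ) :
    (idTensor M).conjTranspose = idTensor M.conjTranspose := by
  ext i j
  simp only [Matrix.conjTranspose_apply, idTensor, eq_comm (a := i 0)]
  split_ifs <;> simp

theorem conjTranspose_jonesWenzl (k : ℕ) :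
    (jonesWenzl N k).conjTranspose = jonesWenzl N k := by
  induction k with
  | zero => simp [jonesWenzl]
  | succ k ih =>
    rcases k with _ | k
    · simp [jonesWenzl]
    · simp only [jonesWenzl, Matrix.conjTranspose_sub, Matrix.conjTranspose_smul,
        Matrix.conjTranspose_mul, conjTranspose_idTensor, ih, Matrix.conjTranspose_conjTranspose,
        Complex.star_def, Complex.conj_ofReal, Matrix.mul_assoc]

theorem jonesWenzl_mul_self (hN : 3 ≤ N) (k : ℕ) :
    jonesWenzl N k * jonesWenzl N k = jonesWenzl N k := by
  have : Nonempty (Fin N) := ⟨⟨0, by omega⟩⟩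
  apply wordOp_injective (splitAt N 0 k) (splitAt N 0 k)
  rw [wordOp_mul _ (splitAt N 0 k), wordOp_jonesWenzl]
  exact (capCup_infTensor N).wenzl_absorb (isQuantumInt_qParam_complex hN) le_rfl le_rfl

theorem idTensor_mul {k : ℕ} (M M' : Matrix (Word N k) (Word N k) ℂ) :
    idTensor (M * M') = idTensor M * idTensor M' := by
  ext i j
  rw [Matrix.mul_apply, ← (Fin.consEquiv fun _ => Fin N).sum_comp, Fintype.sum_prod_type,
    Finset.sum_eq_single (i 0)]
  · simp only [idTensor, Matrix.mul_apply, Fin.consEquiv, Equiv.coe_fn_mk, Fin.cons_zero,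
      Fin.tail_cons, if_true]
    split_ifs <;> simp
  · intro x _ hx
    simp [idTensor, Fin.consEquiv, hx.symm]
  · simp

theorem trace_idTensor {k : ℕ} (M : Matrix (Word N k) (Word N k) ℂ) :
    (idTensor M).trace = N * M.trace := by
  rw [Matrix.trace, ← (Fin.consEquiv fun _ => Fin N).sum_comp, Fintype.sum_prod_type]
  simp [idTensor, Fin.consEquiv, Matrix.trace]

/-- Closing the diagram, the extra strand with its cup and cap straightens into the closure of the
first strand of M. -/
theorem trace_idTensor_mul_cup {k : ℕ} (M : Matrix (Word N (k + 1)) (Word N (k + 1)) ℂ) :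
    (idTensor M * (cupTensor N k * (cupTensor N k).conjTranspose)).trace = M.trace := by
  have e : ∀ (u : Word N k) (F : Word N (k + 2) → ℂ), ∑ v, cupTensor N k v u * F v =
      ∑ x : Fin N, F (Fin.cons x (Fin.cons x u : Word N (k + 1))) := by
    intro u F
    simp only [cupTensor_eq_sum, Finset.sum_mul]
    rw [Finset.sum_comm]
    simp
  have e' : ∀ (v : Word N (k + 2)) (u : Word N k), star (cupTensor N k v u) =
      cupTensor N k v u := by
    intro v u
    simp only [cupTensor]
    split_ifs <;> simp
  rw [← Matrix.mul_assoc, Matrix.trace_mul_cycle]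
  simp only [Matrix.trace, Matrix.diag_apply]
  rw [← (Fin.consEquiv fun _ => Fin N).sum_comp, Fintype.sum_prod_type, Finset.sum_comm]
  refine Finset.sum_congr rfl fun u _ => ?_
  rw [Matrix.mul_apply]
  simp only [mul_comm _ (cupTensor N k _ u), e, Matrix.mul_apply, Matrix.conjTranspose_apply, e']
  simp [idTensor, Fin.consEquiv]

/-- Taking traces in the Wenzl recursion gives N[k+2] - ([k+1]/[k+2])[k+2] = [k+3]. -/
theorem trace_jonesWenzl (hN : 3 ≤ N) (k : ℕ) :
    (jonesWenzl N k).trace = ((qInt (qParam N) (k + 1) : ℝ) : ℂ) := by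
  have hn := isQuantumInt_qParam_complex hN
  induction k with
  | zero => simp [jonesWenzl, hn.one, Matrix.trace_one]
  | succ k ih =>
    rcases k with _ | k
    · have := hn.step 0
      simp only [hn.one, hn.zero] at this
      simp [jonesWenzl, Matrix.trace_one, this]
    · rw [jonesWenzl, Matrix.trace_sub, Matrix.trace_smul, Matrix.trace_mul_cycle,
        ← Matrix.mul_assoc, ← idTensor_mul, jonesWenzl_mul_self hN, trace_idTensor, Matrix.mul_assoc,
        trace_idTensor_mul_cup, ih, hn.step (k + 1)]
      have := hn.ne_zero (k + 1)
      push_cast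
      rw [smul_eq_mul, div_mul_cancel₀ _ this]

/-- The matrix of the three-vertex on all of `H₁^{⊗k}`. -/
noncomputable def vertexMatrix (N a b r : ℕ) : Matrix (Word N (a + r) × Word N (b + r)) (Word N (a + b)) ℂ :=
  (jonesWenzl N (a + r) ⊗ₖ jonesWenzl N (b + r)) * nestedCup N (a + b) (a + r) (b + r) r *
    jonesWenzl N (a + b)

theorem conjTranspose_mul_vertexMatrix (hN : 3 ≤ N) (a b r : ℕ) :
    (vertexMatrix N a b r).conjTranspose * vertexMatrix N a b r =
      ((∏ i ∈ Finset.range r, arcFactor (qInt (qParam N)) a b (i + 1) : ℝ) : ℂ) •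
        jonesWenzl N (a + b) := by
  have : Nonempty (Fin N) := ⟨⟨0, by omega⟩⟩
  have hn := isQuantumInt_qParam_complex hN
  have hb := (capCup_infTensor N).bubble hn a b (arcFactor _ a b) (by simp [arcFactor, hn.zero])
    (arcFactor_succ hn a b) r
  have hP : (jonesWenzl N (a + r) ⊗ₖ jonesWenzl N (b + r)) *
      (jonesWenzl N (a + r) ⊗ₖ jonesWenzl N (b + r)) =
      (jonesWenzl N (a + r) ⊗ₖ jonesWenzl N (b + r)) := by
    rw [← Matrix.mul_kronecker_mul, jonesWenzl_mul_self hN, jonesWenzl_mul_self hN]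
  have e : (vertexMatrix N a b r).conjTranspose * vertexMatrix N a b r =
      jonesWenzl N (a + b) * ((nestedCup N (a + b) (a + r) (b + r) r).conjTranspose *
        ((jonesWenzl N (a + r) ⊗ₖ jonesWenzl N (b + r)) *
          (nestedCup N (a + b) (a + r) (b + r) r * jonesWenzl N (a + b)))) := by
    -- The product of the vertex with its adjoint contains the projection p_l ⊗ p_m twice, so it is
    -- doubled on the other side.
    rw [← hP]
    simp only [vertexMatrix, Matrix.conjTranspose_mul, Matrix.conjTranspose_kronecker,
      conjTranspose_jonesWenzl, Matrix.mul_assoc]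
  apply wordOp_injective (splitAt N 0 (a + b)) (splitAt N 0 (a + b))
  rw [e, wordOp_mul _ (splitAt N 0 (a + b)), wordOp_mul _ (splitPair N (a + r) (b + r)),
    wordOp_mul _ (splitPair N (a + r) (b + r)), wordOp_mul _ (splitAt N 0 (a + b)),
    wordOp_smul, wordOp_nestedCup, wordOp_nestedCup_conjTranspose, wordOp_kronecker,
    wordOp_jonesWenzl, wordOp_jonesWenzl, wordOp_jonesWenzl, hb]
  congr 1
  simp [arcFactor]

end Matrices
-- Bounds on the arc factors and on the infinite product.
section Estimates

theorem pow_mul_qInt {q : ℝ} (hq : q ≠ 0) (m : ℕ) :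
    q ^ m * qInt q m = q / (1 - q ^ 2) * (1 - q ^ (2 * m)) := by
  have : q ^ m * q⁻¹ ^ m = 1 := by rw [← mul_pow, mul_inv_cancel₀ hq, one_pow]
  rw [qInt_eq hq, pow_mul']
  linear_combination q / (1 - q ^ 2) * this

theorem arcFactor_pos {q : ℝ} (hq : 0 < q) (hq1 : q < 1) (a b i : ℕ) :
    0 < arcFactor (qInt q) a b (i + 1) := by
  have h1 := qInt_pos hq hq1 i
  have h2 := qInt_pos hq hq1 (a + b + (i + 1))
  have h3 := qInt_pos hq hq1 (a + i)
  have h4 := qInt_pos hq hq1 (b + i)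
  rw [arcFactor, ← add_assoc a i, ← add_assoc b i]
  positivity

/-- Since [n] is proportional to q^{-n}(1 - q^{2n}), the powers of q leave exactly one q, and the
rest is (1-q^{2(a+r)})(1-q^{2(b+r)}) / ((1-q^{2r})(1-q^{2(a+b+r+1)})), where r stands for i + 1. -/
theorem inv_arcFactor_le {q : ℝ} (hq : 0 < q) (hq1 : q < 1) (a b i : ℕ) :
    (arcFactor (qInt q) a b (i + 1))⁻¹ ≤ q * (1 / (1 - q ^ (2 * (i + 1)))) := by
  set r := i + 1 with hr
  have hx : 0 < 1 - q ^ (2 * r) := sub_pos.2 (pow_lt_one₀ hq.le hq1 (by omega))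
  have hK : 0 < q / (1 - q ^ 2) := div_pos hq (sub_pos.2 (pow_lt_one₀ hq.le hq1 (by omega)))
  have h1 : 0 < qInt q r := qInt_pos hq hq1 i
  have h2 : 0 < qInt q (a + b + r + 1) := qInt_pos hq hq1 _
  -- The left side is at most its first factor, and a + r ≤ a + b + r + 1.
  have h5 : (1 - q ^ (2 * (a + r))) * (1 - q ^ (2 * (b + r))) ≤ 1 - q ^ (2 * (a + b + r + 1)) := by
    have e1 : q ^ (2 * (a + b + r + 1)) ≤ q ^ (2 * (a + r)) :=
      pow_le_pow_of_le_one hq.le hq1.le (by omega)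
    have e2 : 0 ≤ q ^ (2 * (b + r)) := by positivity
    have e3 : q ^ (2 * (a + r)) ≤ 1 := pow_le_one₀ hq.le hq1.le
    nlinarith
  have e : qInt q (a + r) * qInt q (b + r) * (1 - q ^ (2 * r)) ≤
      q * (qInt q r * qInt q (a + b + r + 1)) := by
    have hp : 0 < q ^ (a + r) * q ^ (b + r) := by positivity
    refine le_of_mul_le_mul_left ?_ hp
    have l : q ^ (a + r) * q ^ (b + r) * (qInt q (a + r) * qInt q (b + r) * (1 - q ^ (2 * r))) =
        (q / (1 - q ^ 2)) ^ 2 * (1 - q ^ (2 * r)) *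
          ((1 - q ^ (2 * (a + r))) * (1 - q ^ (2 * (b + r)))) := by
      linear_combination (1 - q ^ (2 * r)) * (q ^ (b + r) * qInt q (b + r)) *
        pow_mul_qInt hq.ne' (a + r) + (1 - q ^ (2 * r)) * (q / (1 - q ^ 2) *
        (1 - q ^ (2 * (a + r)))) * pow_mul_qInt hq.ne' (b + r)
    have l' : q ^ (a + r) * q ^ (b + r) * (q * (qInt q r * qInt q (a + b + r + 1))) =
        (q / (1 - q ^ 2)) ^ 2 * (1 - q ^ (2 * r)) * (1 - q ^ (2 * (a + b + r + 1))) := by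
      have : q ^ (a + r) * q ^ (b + r) * q = q ^ r * q ^ (a + b + r + 1) := by ring
      linear_combination (qInt q r * qInt q (a + b + r + 1)) * this +
        (q ^ (a + b + r + 1) * qInt q (a + b + r + 1)) * pow_mul_qInt hq.ne' r +
        (q / (1 - q ^ 2) * (1 - q ^ (2 * r))) * pow_mul_qInt hq.ne' (a + b + r + 1)
    rw [l, l']
    exact mul_le_mul_of_nonneg_left h5 (by positivity)
  rw [arcFactor, inv_div, mul_one_div, div_le_div_iff₀ (mul_pos h1 h2) hx]
  exact e

theorem one_le_one_div_one_sub {q : ℝ} (hq : 0 < q) (hq1 : q < 1) (s : ℕ) :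
    1 ≤ 1 / (1 - q ^ (2 * (s + 1))) := by
  have hx : 0 < 1 - q ^ (2 * (s + 1)) := sub_pos.2 (pow_lt_one₀ hq.le hq1 (by omega))
  rw [le_div_iff₀ hx]
  have : 0 < q ^ (2 * (s + 1)) := by positivity
  linarith

theorem multipliable_one_div_one_sub {q : ℝ} (hq : 0 < q) (hq1 : q < 1) :
    Multipliable fun s : ℕ => 1 / (1 - q ^ (2 * (s + 1))) := by
  have hK : 0 < 1 - q ^ 2 := sub_pos.2 (pow_lt_one₀ hq.le hq1 (by omega))
  have hs : Summable fun s : ℕ => 1 / (1 - q ^ (2 * (s + 1))) - 1 := by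
    have hg : Summable fun s : ℕ => q ^ s * (1 / (1 - q ^ 2)) :=
      (summable_geometric_of_lt_one hq.le hq1).mul_right _
    refine hg.of_nonneg_of_le (fun s => sub_nonneg.2 (one_le_one_div_one_sub hq hq1 s)) fun s => ?_
    have hx : 0 < 1 - q ^ (2 * (s + 1)) := sub_pos.2 (pow_lt_one₀ hq.le hq1 (by omega))
    have h1 : q ^ (2 * (s + 1)) ≤ q ^ s := pow_le_pow_of_le_one hq.le hq1.le (by omega)
    have h2 : q ^ (2 * (s + 1)) ≤ q ^ 2 := pow_le_pow_of_le_one hq.le hq1.le (by omega)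
    rw [div_sub_one hx.ne', sub_sub_cancel, mul_one_div]
    gcongr
  simpa using Real.multipliable_one_add_of_summable hs

/-- All factors are at least 1, so the partial products increase to the limit. -/
theorem prod_le_tprod_one_div_one_sub {q : ℝ} (hq : 0 < q) (hq1 : q < 1) (r : ℕ) :
    ∏ s ∈ Finset.range r, 1 / (1 - q ^ (2 * (s + 1))) ≤
      ∏' s : ℕ, 1 / (1 - q ^ (2 * (s + 1))) := by
  have hm : Monotone fun r => ∏ s ∈ Finset.range r, 1 / (1 - q ^ (2 * (s + 1))) := by
    refine monotone_nat_of_le_succ fun r => ?_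
    rw [Finset.prod_range_succ]
    refine le_mul_of_one_le_right (Finset.prod_nonneg fun s _ => ?_)
      (one_le_one_div_one_sub hq hq1 r)
    exact zero_le_one.trans (one_le_one_div_one_sub hq hq1 s)
  exact hm.ge_of_tendsto (multipliable_one_div_one_sub hq hq1).hasProd.tendsto_prod_nat r

theorem inv_prod_arcFactor_le {q : ℝ} (hq : 0 < q) (hq1 : q < 1) (a b r : ℕ) :
    (∏ i ∈ Finset.range r, arcFactor (qInt q) a b (i + 1))⁻¹ ≤
      q ^ r * ∏' s : ℕ, 1 / (1 - q ^ (2 * (s + 1))) := by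
  calc (∏ i ∈ Finset.range r, arcFactor (qInt q) a b (i + 1))⁻¹
      ≤ ∏ i ∈ Finset.range r, q * (1 / (1 - q ^ (2 * (i + 1)))) := by
        rw [← Finset.prod_inv_distrib]
        exact Finset.prod_le_prod (fun i _ => (inv_pos.2 (arcFactor_pos hq hq1 a b i)).le)
          fun i _ => inv_arcFactor_le hq hq1 a b i
    _ = q ^ r * ∏ s ∈ Finset.range r, 1 / (1 - q ^ (2 * (s + 1))) := by
        rw [Finset.prod_mul_distrib, Finset.prod_const, Finset.card_range]
    _ ≤ _ := by gcongr; exact prod_le_tprod_one_div_one_sub hq hq1 r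

/-- Deliberately lossy: the infinite product is at least 1, so its exponent 1/2 may be raised to
3/2, and (1-q²)^{-1/2} ≥ 1 is put in for free. -/
theorem sqrt_le_rdConst_mul {q : ℝ} (hq : 0 < q) (hq1 : q < 1) (r : ℕ) :
    (q ^ r * ∏' s : ℕ, 1 / (1 - q ^ (2 * (s + 1)))) ^ (1 / 2 : ℝ) ≤
      rdConst q * q ^ ((r : ℝ) / 2) := by
  have hS : 1 ≤ ∏' s : ℕ, 1 / (1 - q ^ (2 * (s + 1))) := by
    simpa using prod_le_tprod_one_div_one_sub hq hq1 0
  rw [rdConst]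
  set S := ∏' s : ℕ, 1 / (1 - q ^ (2 * (s + 1)))
  have hK : 0 < 1 - q ^ 2 := sub_pos.2 (pow_lt_one₀ hq.le hq1 (by omega))
  have hK1 : 1 ≤ (1 - q ^ 2) ^ (-(1 / 2 : ℝ)) :=
    Real.one_le_rpow_of_pos_of_le_one_of_nonpos hK (by nlinarith) (by norm_num)
  have hSS : S ^ (1 / 2 : ℝ) ≤ S ^ (3 / 2 : ℝ) :=
    Real.rpow_le_rpow_of_exponent_le hS (by norm_num)
  have hq2 : (q ^ r) ^ (1 / 2 : ℝ) = q ^ ((r : ℝ) / 2) := by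
    rw [← Real.rpow_natCast, ← Real.rpow_mul hq.le, mul_one_div]
  rw [Real.mul_rpow (by positivity) (by positivity), hq2, mul_comm]
  refine mul_le_mul_of_nonneg_right (hSS.trans ?_) (by positivity)
  exact le_mul_of_one_le_left (by positivity) hK1

end Estimates

/-! ### Norms, theta-nets and contractions on the Hilbert spaces. -/

section HilbertSpaces

variable {N : ℕ}

theorem inner_toEuclideanLin {ι κ : Type*} [Fintype ι] [Fintype κ] [DecidableEq ι] [DecidableEq κ]
    (M : Matrix ι κ ℂ) (x : EuclideanSpace ℂ κ) (y : EuclideanSpace ℂ ι) :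
    inner ℂ (Matrix.toEuclideanLin M x) y =
      inner ℂ x (Matrix.toEuclideanLin M.conjTranspose y) := by
  rw [Matrix.toEuclideanLin_conjTranspose_eq_adjoint, LinearMap.adjoint_inner_right]

theorem toEuclideanLin_mul_apply {ι κ μ : Type*} [Fintype κ] [Fintype μ]
    [DecidableEq κ] [DecidableEq μ] (M : Matrix ι κ ℂ) (M' : Matrix κ μ ℂ)
    (x : EuclideanSpace ℂ μ) :
    Matrix.toEuclideanLin (M * M') x = Matrix.toEuclideanLin M (Matrix.toEuclideanLin M' x) := by
  simp [Matrix.toLpLin_apply]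

theorem jonesWenzl_apply_of_mem (hN : 3 ≤ N) {k : ℕ} {x : TensorPow N k}
    (hx : x ∈ irrepSpace N k) : Matrix.toEuclideanLin (jonesWenzl N k) x = x := by
  obtain ⟨y, rfl⟩ := hx
  rw [← toEuclideanLin_mul_apply, jonesWenzl_mul_self hN]

/-- The dimension of the range of a projection is its trace. -/
theorem finrank_irrepSpace (hN : 3 ≤ N) (k : ℕ) :
    (Module.finrank ℂ (irrepSpace N k) : ℝ) = qInt (qParam N) (k + 1) := by
  have hp : LinearMap.IsProj (irrepSpace N k) (Matrix.toEuclideanLin (jonesWenzl N k)) :=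
    ⟨fun x => ⟨x, rfl⟩, fun x hx => jonesWenzl_apply_of_mem hN hx⟩
  have h1 := hp.trace
  have h2 : LinearMap.trace ℂ _ (Matrix.toEuclideanLin (jonesWenzl N k)) =
      (jonesWenzl N k).trace :=
    Matrix.trace_toLin_eq _ (PiLp.basisFun 2 ℂ (Word N k))
  rw [h2, trace_jonesWenzl hN] at h1
  exact_mod_cast h1.symm

theorem threeVertex_apply {a b r : ℕ} (x : irrepSpace N (a + b)) :
    threeVertex N (a + b) (a + r) (b + r) x =
      Matrix.toEuclideanLin (vertexMatrix N a b r) (x : TensorPow N (a + b)) := by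
  rw [threeVertex, show (a + r + (b + r) - (a + b)) / 2 = r by omega]
  rfl

/-- The bubble identity on vectors: the three-vertex is a scalar multiple of an isometry, which
yields both its theta-net and its norms. -/
theorem inner_threeVertex (hN : 3 ≤ N) {a b r : ℕ} (x y : irrepSpace N (a + b)) :
    inner ℂ (threeVertex N (a + b) (a + r) (b + r) x) (threeVertex N (a + b) (a + r) (b + r) y) =
      ((∏ i ∈ Finset.range r, arcFactor (qInt (qParam N)) a b (i + 1) : ℝ) : ℂ) *
        inner ℂ (x : TensorPow N (a + b)) (y : TensorPow N (a + b)) := by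
  rw [threeVertex_apply, threeVertex_apply, inner_toEuclideanLin, ← toEuclideanLin_mul_apply,
    conjTranspose_mul_vertexMatrix hN, map_smul, LinearMap.smul_apply,
    jonesWenzl_apply_of_mem hN y.2, inner_smul_right]

theorem thetaNet_eq (hN : 3 ≤ N) (a b r : ℕ) :
    thetaNet N (a + b) (a + r) (b + r) =
      (∏ i ∈ Finset.range r, arcFactor (qInt (qParam N)) a b (i + 1)) *
        qInt (qParam N) (a + b + 1) := by
  have h : threeVertexAdj N (a + b) (a + r) (b + r) ∘ₗ
      (threeVertex N (a + b) (a + r) (b + r)).toLinearMap =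
      ((∏ i ∈ Finset.range r, arcFactor (qInt (qParam N)) a b (i + 1) : ℝ) : ℂ) •
        LinearMap.id := by
    refine LinearMap.ext fun x => ext_inner_left ℂ fun y => ?_
    rw [LinearMap.comp_apply, threeVertexAdj, LinearMap.adjoint_inner_right, LinearMap.smul_apply,
      LinearMap.id_apply, Submodule.coe_inner, Submodule.coe_smul, inner_smul_right]
    exact inner_threeVertex hN y x
  rw [thetaNet, h, map_smul, LinearMap.trace_id, smul_eq_mul, Complex.re_ofReal_mul,
    Complex.natCast_re, finrank_irrepSpace hN]

theorem norm_threeVertex_apply_sq (hN : 3 ≤ N) {a b r : ℕ} (x : irrepSpace N (a + b)) :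
    ‖threeVertex N (a + b) (a + r) (b + r) x‖ ^ 2 =
      (∏ i ∈ Finset.range r, arcFactor (qInt (qParam N)) a b (i + 1)) * ‖x‖ ^ 2 := by
  have h := inner_threeVertex hN (r := r) x x
  rw [inner_self_eq_norm_sq_to_K, inner_self_eq_norm_sq_to_K] at h
  apply Complex.ofReal_injective
  rw [Complex.ofReal_pow, Complex.ofReal_mul, Complex.ofReal_pow]
  exact h

theorem norm_tmul {l m : ℕ} (η : TensorPow N l) (ζ : TensorPow N m) :
    ‖tmul η ζ‖ = ‖η‖ * ‖ζ‖ := by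
  rw [← sq_eq_sq₀ (norm_nonneg _) (by positivity), mul_pow]
  simp only [EuclideanSpace.norm_sq_eq, tmul, norm_mul, mul_pow, Fintype.sum_prod_type,
    Finset.sum_mul_sum]

theorem toEuclideanLin_kronecker_tmul {l m : ℕ} (A : Matrix (Word N l) (Word N l) ℂ)
    (B : Matrix (Word N m) (Word N m) ℂ) (η : TensorPow N l) (ζ : TensorPow N m) :
    Matrix.toEuclideanLin (A ⊗ₖ B) (tmul η ζ) =
      tmul (Matrix.toEuclideanLin A η) (Matrix.toEuclideanLin B ζ) := by
  ext w
  simp only [Matrix.toLpLin_apply, tmul, Matrix.mulVec, dotProduct,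
    Matrix.kroneckerMap_apply, Fintype.sum_prod_type, Finset.sum_mul_sum]
  refine Finset.sum_congr rfl fun u _ => Finset.sum_congr rfl fun v _ => ?_
  ring

/-- The contraction of `η ⊗ ζ` along the middle pair of letters. -/
theorem cupPair_conjTranspose_tmul {l m : ℕ} (η : TensorPow N (l + 1)) (ζ : TensorPow N (m + 1)) :
    Matrix.toEuclideanLin (cupPair N l m).conjTranspose (tmul η ζ) =
      ∑ x : Fin N, tmul (WithLp.toLp 2 fun u : Word N l => η (Fin.snoc u x : Word N (l + 1)))
        (WithLp.toLp 2 fun u : Word N m => ζ (Fin.cons x u : Word N (m + 1))) := by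
  ext u
  simp only [Matrix.toLpLin_apply, tmul, Matrix.mulVec, dotProduct,
    Matrix.conjTranspose_apply, cupPair_eq_sum, star_sum, Finset.sum_mul, WithLp.ofLp_sum,
    Finset.sum_apply]
  rw [Finset.sum_comm]
  simp [apply_ite]

theorem sum_norm_sq_snoc {l : ℕ} (η : TensorPow N (l + 1)) :
    ∑ x : Fin N, ‖(WithLp.toLp 2 fun u : Word N l => η (Fin.snoc u x : Word N (l + 1)) :
      TensorPow N l)‖ ^ 2 = ‖η‖ ^ 2 := by
  simp only [EuclideanSpace.norm_sq_eq]
  rw [← (Fin.snocEquiv fun _ => Fin N).sum_comp, Fintype.sum_prod_type]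
  rfl

theorem sum_norm_sq_cons {m : ℕ} (ζ : TensorPow N (m + 1)) :
    ∑ x : Fin N, ‖(WithLp.toLp 2 fun u : Word N m => ζ (Fin.cons x u : Word N (m + 1)) :
      TensorPow N m)‖ ^ 2 = ‖ζ‖ ^ 2 := by
  simp only [EuclideanSpace.norm_sq_eq]
  rw [← (Fin.consEquiv fun _ => Fin N).sum_comp, Fintype.sum_prod_type]
  rfl

/-- Contracting the innermost arc turns η ⊗ ζ into a sum of N product vectors; the triangle
inequality, the induction hypothesis and Cauchy–Schwarz over the contracted letter then suffice.
Product vectors are essential here, as the norm of T_r grows with r. -/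
theorem norm_nestedCup_conjTranspose_tmul_le (a b r : ℕ) (η : TensorPow N (a + r))
    (ζ : TensorPow N (b + r)) :
    ‖Matrix.toEuclideanLin (nestedCup N (a + b) (a + r) (b + r) r).conjTranspose (tmul η ζ)‖ ≤
      ‖η‖ * ‖ζ‖ := by
  induction r with
  | zero =>
    rw [← norm_tmul, ← sq_le_sq₀ (norm_nonneg _) (norm_nonneg _), EuclideanSpace.norm_sq_eq,
      EuclideanSpace.norm_sq_eq]
    have e : ∀ u, Matrix.toEuclideanLin (nestedCup N (a + b) a b 0).conjTranspose (tmul η ζ) u =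
        tmul η ζ (cutWord a b u) := by
      intro u
      simp [Matrix.toLpLin_apply, Matrix.mulVec, dotProduct, nestedCup_zero, apply_ite]
    calc _ = ∑ u, ‖tmul η ζ (cutWord a b u)‖ ^ 2 := Finset.sum_congr rfl fun u _ => by rw [← e]; rfl
      -- Cutting words is injective, which is enough: the coefficients met form a subfamily of those
      -- of η ⊗ ζ.
      _ = ∑ v ∈ Finset.univ.map ⟨_, cutWord_injective a b⟩, ‖tmul η ζ v‖ ^ 2 := by simp
      _ ≤ _ := Finset.sum_le_univ_sum_of_nonneg fun _ => by positivity
  | succ r ih =>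
    change ‖Matrix.toEuclideanLin (nestedCup N (a + b) (a + r + 1) (b + r + 1)
      (r + 1)).conjTranspose (tmul η ζ)‖ ≤ _
    rw [nestedCup_succ (by omega) (by omega), Matrix.conjTranspose_mul, toEuclideanLin_mul_apply,
      cupPair_conjTranspose_tmul, map_sum]
    refine (norm_sum_le _ _).trans ((Finset.sum_le_sum fun x _ => ih _ _).trans ?_)
    refine (Real.sum_mul_le_sqrt_mul_sqrt _ _ _).trans ?_
    rw [sum_norm_sq_snoc, sum_norm_sq_cons, Real.sqrt_sq (norm_nonneg _),
      Real.sqrt_sq (norm_nonneg _)]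

/-- All three projections are self-adjoint or act directly, and they fix ξ, η and ζ, so only the arc
contraction of η ⊗ ζ remains. -/
theorem norm_inner_threeVertex_tmul_le (hN : 3 ≤ N) {a b r : ℕ} (ξ : irrepSpace N (a + b))
    (η : irrepSpace N (a + r)) (ζ : irrepSpace N (b + r)) :
    ‖inner ℂ (threeVertex N (a + b) (a + r) (b + r) ξ)
      (tmul (η : TensorPow N (a + r)) (ζ : TensorPow N (b + r)))‖ ≤ ‖ξ‖ * (‖η‖ * ‖ζ‖) := by
  rw [threeVertex_apply, vertexMatrix, toEuclideanLin_mul_apply, jonesWenzl_apply_of_mem hN ξ.2,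
    toEuclideanLin_mul_apply, inner_toEuclideanLin, Matrix.conjTranspose_kronecker,
    conjTranspose_jonesWenzl, conjTranspose_jonesWenzl, toEuclideanLin_kronecker_tmul,
    jonesWenzl_apply_of_mem hN η.2, jonesWenzl_apply_of_mem hN ζ.2, inner_toEuclideanLin]
  exact (norm_inner_le_norm _ _).trans (mul_le_mul_of_nonneg_left
    (norm_nestedCup_conjTranspose_tmul_le a b r _ _) (norm_nonneg _))

end HilbertSpaces
end FreeOrth

/-! ### The rapid decay inequality. -/

theorem proposition3p1 (N : ℕ) (hN : 3 ≤ N) (k l m : ℕ) (h : FreeOrth.Admissible k l m) :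
    (∀ (ξ : FreeOrth.irrepSpace N k) (η : FreeOrth.irrepSpace N l) (ζ : FreeOrth.irrepSpace N m),
      ‖ξ‖ = 1 → ‖η‖ = 1 → ‖ζ‖ = 1 →
        ‖inner ℂ (FreeOrth.alpha N k l m ξ)
            (FreeOrth.tmul (η : FreeOrth.TensorPow N l) (ζ : FreeOrth.TensorPow N m))‖ ≤
          (FreeOrth.qInt (FreeOrth.qParam N) (k + 1) / FreeOrth.thetaNet N k l m) ^ (1 / 2 : ℝ)) ∧
    (FreeOrth.qInt (FreeOrth.qParam N) (k + 1) / FreeOrth.thetaNet N k l m) ^ (1 / 2 : ℝ) ≤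
      FreeOrth.rdConst (FreeOrth.qParam N) *
        FreeOrth.qParam N ^ (((l : ℝ) + (m : ℝ) - (k : ℝ)) / 4) := by
  obtain ⟨r, hr, hk⟩ := h
  obtain ⟨a, rfl⟩ : ∃ a, l = a + r := ⟨l - r, by omega⟩
  obtain ⟨b, rfl⟩ : ∃ b, m = b + r := ⟨m - r, by omega⟩
  obtain rfl : k = a + b := by omega
  have hq := FreeOrth.qParam_pos hN
  have hq1 := FreeOrth.qParam_lt_one hN
  have hc : 0 < ∏ i ∈ Finset.range r,
      FreeOrth.arcFactor (FreeOrth.qInt (FreeOrth.qParam N)) a b (i + 1) :=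
    Finset.prod_pos fun i _ => FreeOrth.arcFactor_pos hq hq1 a b i
  -- The factor [k+1] cancels, leaving λ^{-1} under the square root.
  rw [FreeOrth.thetaNet_eq hN, div_mul_cancel_right₀ (FreeOrth.qInt_pos hq hq1 (a + b)).ne']
  constructor
  · intro ξ η ζ hξ hη hζ
    have h1 := FreeOrth.norm_inner_threeVertex_tmul_le hN ξ η ζ
    have h2 := FreeOrth.norm_threeVertex_apply_sq hN (r := r) ξ
    rw [hξ, hη, hζ, mul_one, mul_one] at h1
    rw [hξ, one_pow, mul_one] at h2
    -- Only ‖A‖ ≥ ‖Aξ‖ = λ^{1/2} is needed, not the exact operator norm.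
    have h3 := (FreeOrth.threeVertex N (a + b) (a + r) (b + r)).le_opNorm ξ
    rw [hξ, mul_one] at h3
    have h4 : 0 < ‖FreeOrth.threeVertex N (a + b) (a + r) (b + r) ξ‖ := by
      refine (norm_nonneg _).lt_of_ne fun h => ?_
      rw [← h] at h2
      simp only [ne_eq, OfNat.ofNat_ne_zero, not_false_eq_true, zero_pow] at h2
      exact hc.ne h2
    rw [← h2, ← inv_pow, ← Real.sqrt_eq_rpow, Real.sqrt_sq (by positivity), FreeOrth.alpha,
      smul_apply, inner_smul_left, Complex.conj_ofReal, norm_mul,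
      Complex.norm_real, Real.norm_of_nonneg (inv_nonneg.2 (h4.le.trans h3))]
    calc _ ≤ ‖FreeOrth.threeVertex N (a + b) (a + r) (b + r)‖⁻¹ * 1 := by gcongr
      _ ≤ _ := by rw [mul_one]; gcongr
  · refine (Real.rpow_le_rpow (inv_pos.2 hc).le
      (FreeOrth.inv_prod_arcFactor_le hq hq1 a b r) (by norm_num)).trans ?_
    -- The exponent (l+m-k)/4 is r/2, the square root of the q^r gained from r arcs.
    have e : (((a + r : ℕ) : ℝ) + ((b + r : ℕ) : ℝ) - ((a + b : ℕ) : ℝ)) / 4 = (r : ℝ) / 2 := by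
      push_cast
      ring
    rw [e]
    exact FreeOrth.sqrt_le_rdConst_mul hq hq1 r
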